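/- **Corollary (Multivariable Version of the Bilinear Embedding Theorem).** Write $\mathcal D^n$ for the collection of dyadic cubes $Q=\prod_{i=1}^n[m_i2^{-k},(m_i+1)2^{-k})$ ($k,m_1,\dots,m_n\in\mathbb Z$) of $\mathbb R^n$, $n\ge1$, and $\mathcal D^n(Q')=\{Q\in\mathcal D^n: Q\subseteq Q'\}$. Write $|E|$ for the Lebesgue measure of $E$ and $\langle f\rangle_E=\frac1{|E|}\int_E f$. For $Q\in\mathcal D^n$ let $(E^1_{j,Q},E^2_{j,Q})$, $1\le j\le 2^n-1$, be Wilson's pairs of sets, defined by induction on $n$: write $Q=\widetilde Q\times I$ with an $(n-1)$-dimensional dyadic cube $\widetilde Q$ and a dyadic interval $I$ with left and right halves $I_-,I_+$; then $(E^1_{1,Q},E^2_{1,Q})=(\widetilde Q\times I_-,\widetilde Q\times I_+)$ and, for $1\le j\le 2^{n-1}-1$, $(E^1_{2j,Q},E^2_{2j,Q})=(E^1_{j,\widetilde Q}\times I_-,E^2_{j,\widetilde Q}\times I_-)$ and $(E^1_{2j+1,Q},E^2_{2j+1,Q})=(E^1_{j,\widetilde Q}\times I_+,E^2_{j,\widetilde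 Q}\times I_+)$. Put $E_{j,Q}=E^1_{j,Q}\cup E^2_{j,Q}$. A weight is an almost everywhere positive, locally integrable function. There is an absolute constant $C>0$ (in particular independent of $n$) with the following property. Let $n\ge1$, let $w$ and $v$ be weights on $\mathbb R^n$, let $\{\alpha_{j,Q}\}_{Q\in\mathcal D^n,\,1\le j\le 2^n-1}$ be nonnegative numbers and let $A>0$ be such that for all $Q'\in\mathcal D^n$ and $i=1,\dots,2^n-1$ $$\frac1{|E_{i,Q'}|}\sum_{Q\in\mathcal D^n(Q')}\ \sum_{j:\,E_{j,Q}\subseteq E_{i,Q'}}\alpha_{j,Q}\langle v\rangle_{E_{j,Q}}|E_{j,Q}|\le A\langle v\rangle_{E_{i,Q'}},$$ $$\frac1{|E_{i,Q'}|}\sum_{Q\in\mathcal D^n(Q')}\ \sum_{j:\,E_{j,Q}\subseteq E_{i,Q'}}\alpha_{j,Q}\langle w\rangle_{E_{j,Q}}|E_{j,Q}|\le A\langle w\rangle_{E_{i,Q'}},$$ $$\frac1{|E_{i,Q'}|}\sum_{Q\in\mathcal D^n(Q')}\ \sum_{j:\,E_{j,Q}\subseteq E_{i,Q'}}\alpha_{j,Q}\langle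 w\rangle_{E_{j,Q}}\langle v\rangle_{E_{j,Q}}|E_{j,Q}|\le A.$$ Then for all real-valued $f,g\in L^2(\mathbb R^n)$ $$\sum_{Q\in\mathcal D^n}\ \sum_{j=1}^{2^n-1}\big|\alpha_{j,Q}\,\langle fw^{1/2}\rangle_{E_{j,Q}}\langle gv^{1/2}\rangle_{E_{j,Q}}\,|E_{j,Q}|\big|\le C\,A\,\|f\|_{L^2(\mathbb R^n)}\|g\|_{L^2(\mathbb R^n)};$$ in particular the sum converges absolutely. -/

import Mathlib

open MeasureTheory
open scoped ENNReal NNReal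

noncomputable section

/-- Dyadic cubes of `ℝⁿ`, encoded by the scale `k` and the position `m`: the cube is the product of
the intervals `[mᵢ 2⁻ᵏ, (mᵢ + 1) 2⁻ᵏ)`. For `n ≥ 1` different data give different cubes. -/
structure DyadicCube (n : ℕ) where
  scale : ℤ
  pos : Fin n → ℤ

namespace DyadicCube

/-- The side length `ℓ(Q) = 2⁻ᵏ`. -/
def side {n : ℕ} (Q : DyadicCube n) : ℝ := (2 : ℝ) ^ (-Q.scale)

/-- The cube as a subset of `ℝⁿ`. -/
def toSet {n : ℕ} (Q : DyadicCube n) : Set (Fin n → ℝ) :=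
  {x | ∀ i, x i ∈ Set.Ico ((Q.pos i : ℝ) * Q.side) (((Q.pos i : ℝ) + 1) * Q.side)}

/-- The `n`-dimensional cube `Q̃` in the decomposition `Q = Q̃ × I` of an `(n+1)`-dimensional cube. -/
def base {n : ℕ} (Q : DyadicCube (n + 1)) : DyadicCube n :=
  ⟨Q.scale, Fin.init Q.pos⟩

/-- The left half `I₋` of the last side `I` in `Q = Q̃ × I`. -/
def lastLower {n : ℕ} (Q : DyadicCube (n + 1)) : Set ℝ :=
  Set.Ico ((Q.pos (Fin.last n) : ℝ) * Q.side) (((Q.pos (Fin.last n) : ℝ) + 1 / 2) * Q.side)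

/-- The right half `I₊` of the last side `I` in `Q = Q̃ × I`. -/
def lastUpper {n : ℕ} (Q : DyadicCube (n + 1)) : Set ℝ :=
  Set.Ico (((Q.pos (Fin.last n) : ℝ) + 1 / 2) * Q.side) (((Q.pos (Fin.last n) : ℝ) + 1) * Q.side)

end DyadicCube

/-- The product `S × I ⊆ ℝⁿ⁺¹` of `S ⊆ ℝⁿ` and `I ⊆ ℝ`. -/
def prodLast {n : ℕ} (S : Set (Fin n → ℝ)) (I : Set ℝ) : Set (Fin (n + 1) → ℝ) :=
  {x | Fin.init x ∈ S ∧ x (Fin.last n) ∈ I}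

/-- Wilson's pairs `(E¹_{j,Q}, E²_{j,Q})`, `1 ≤ j ≤ 2ⁿ - 1`, by induction on the dimension, with
`Q = Q̃ × I`: the first pair is `(Q̃ × I₋, Q̃ × I₊)`; the pair with number `2j` is
`(E¹_{j,Q̃} × I₋, E²_{j,Q̃} × I₋)`; the pair with number `2j + 1` is
`(E¹_{j,Q̃} × I₊, E²_{j,Q̃} × I₊)`. (Values at `j` outside `1, …, 2ⁿ - 1` are never used.) -/
def wilsonPair : (n : ℕ) → DyadicCube n → ℕ → Set (Fin n → ℝ) × Set (Fin n → ℝ)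
  | 0, _, _ => (∅, ∅)
  | _ + 1, Q, j =>
    if j = 1 then
      (prodLast Q.base.toSet Q.lastLower, prodLast Q.base.toSet Q.lastUpper)
    else if j % 2 = 0 then
      (prodLast (wilsonPair _ Q.base (j / 2)).1 Q.lastLower,
        prodLast (wilsonPair _ Q.base (j / 2)).2 Q.lastLower)
    else
      (prodLast (wilsonPair _ Q.base (j / 2)).1 Q.lastUpper,
        prodLast (wilsonPair _ Q.base (j / 2)).2 Q.lastUpper)

/-- Wilson's rectangles `E_{j,Q} = E¹_{j,Q} ∪ E²_{j,Q}`. -/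
def wilsonSet {n : ℕ} (j : ℕ) (Q : DyadicCube n) : Set (Fin n → ℝ) :=
  (wilsonPair n Q j).1 ∪ (wilsonPair n Q j).2

/-- The index set `{1, …, 2ⁿ - 1}`. -/
def wilsonIndices (n : ℕ) : Finset ℕ := Finset.Icc 1 (2 ^ n - 1)

/-- The Lebesgue measure `|E|` as a real number. -/
def vol {n : ℕ} (E : Set (Fin n → ℝ)) : ℝ := (volume : Measure (Fin n → ℝ)).real E

/-- The average `⟨f⟩_E = |E|⁻¹ ∫_E f`. -/
def avg {n : ℕ} (f : (Fin n → ℝ) → ℝ) (E : Set (Fin n → ℝ)) : ℝ := (vol E)⁻¹ * ∫ x in E, f x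

/-- A weight: an almost everywhere positive, locally integrable function. -/
def IsWeight {n : ℕ} (w : (Fin n → ℝ) → ℝ) : Prop :=
  (∀ᵐ x, 0 < w x) ∧ LocallyIntegrable w

open Classical in
/-- The sum `∑_{Q ∈ 𝒟ⁿ(Q')} ∑_{j : E_{j,Q} ⊆ E_{i,Q'}} β_{j,Q}` of nonnegative numbers `β_{j,Q}`,
with values in `[0, ∞]`; here `𝒟ⁿ(Q')` is the set of the dyadic subcubes of `Q'`. -/
def localSum {n : ℕ} (β : ℕ → DyadicCube n → ℝ≥0∞) (i : ℕ) (Q' : DyadicCube n) : ℝ≥0∞ :=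
  ∑' Q : {Q : DyadicCube n // Q.toSet ⊆ Q'.toSet},
    ∑ j ∈ (wilsonIndices n).filter (fun j => wilsonSet j Q.1 ⊆ wilsonSet i Q'), β j Q.1

/-- The condition `|E_{i,Q'}|⁻¹ ∑_{Q ∈ 𝒟ⁿ(Q')} ∑_{j : E_{j,Q} ⊆ E_{i,Q'}} β_{j,Q} ≤ K_{i,Q'}` for all
dyadic cubes `Q'` and all `i = 1, …, 2ⁿ - 1`; in particular these sums are finite. The numbers
`β_{j,Q}` are meant to be nonnegative. -/
def CarlesonCondition {n : ℕ} (β K : ℕ → DyadicCube n → ℝ) : Prop :=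
  ∀ Q' : DyadicCube n, ∀ i ∈ wilsonIndices n,
    (ENNReal.ofReal (vol (wilsonSet i Q')))⁻¹ * localSum (fun j Q => ENNReal.ofReal (β j Q)) i Q' ≤
      ENNReal.ofReal (K i Q')

end

/-! Put `σ = w dx`, `ω = v dx`, `F = |f| / √w`, `G = |g| / √v`. Then `∫_E F dσ = ∫_E |f| √w`, the
norm of `F` in `L²(σ)` is at most `‖f‖`, and likewise for `G` (`IsWeight.exists_quotient`). The only
geometric input is that any two rectangles `E_{j,Q}` are nested or disjoint (`wilsonSet_laminar`).
The dimension thus disappears: what remains is a bilinear embedding for a finite laminar family with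
three Carleson conditions, normalised to constant 1 (`bilinear_embedding_laminar`).

Split the family by which of `⟨F⟩_σ² σ(I)` and `⟨G⟩_ω² ω(I)` is larger; by symmetry let `F` dominate
(`sum_le_of_dominated`). The stopping sets are the records, where the dyadic level of `⟨F⟩_σ`
exceeds its level on all larger members. Each `I` belongs to the corona of the smallest record `J ⊇
I`, and `⟨F⟩_I ≤ 2 ⟨F⟩_J`. When tested on such `I`, `G` may be replaced by its averages on the
children of `J`. Young's inequality leaves two kinds of terms. The operator terms are at most a
multiple of `⟨F⟩_J² σ(J)` by a testing condition, which follows from the bilinear and one linear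
Carleson condition (`lintegral_sq_le_of_carleson`). The squares of the averaged `G` sum to at most
`∫ G² dω` plus child terms `⟨G⟩_K² ω(K)`, and domination turns the latter into `⟨F⟩_K² σ(K)`. The
Carleson embedding over records (`sum_records_avg_sq_le`) bounds everything by `∫ F² dσ + ∫ G² dω`,
and homogeneity turns the sum of squares into a product. -/

theorem ENNReal.mul_le_sq_add_sq (x y : ℝ≥0∞) : x * y ≤ x ^ 2 + y ^ 2 := by
  rcases le_total x y with h | h
  · calc x * y ≤ y * y := by gcongr
      _ = y ^ 2 := (sq y).symm
      _ ≤ _ := le_add_self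
  · calc x * y ≤ x * x := by gcongr
      _ = x ^ 2 := (sq x).symm
      _ ≤ _ := le_self_add

/-- By induction on the maximum `a`: the smaller powers together are at most `2 ^ a`, so adding `2 ^
a` at most doubles it. -/
theorem sum_two_zpow_le (t : Finset ℤ) :
    ∀ M : ℤ, (∀ z ∈ t, z < M) → ∑ z ∈ t, (2 : ℝ≥0∞) ^ z ≤ 2 ^ M := by
  induction t using Finset.induction_on_max with
  | empty => simp
  | insert a s hs ih =>
    intro M hM
    rw [Finset.sum_insert (fun h => lt_irrefl _ (hs a h))]
    calc (2 : ℝ≥0∞) ^ a + ∑ z ∈ s, (2 : ℝ≥0∞) ^ z ≤ 2 ^ a + 2 ^ a := by gcongr; exact ih a hs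
      _ = 2 ^ (a + 1) := by
        rw [ENNReal.zpow_add (by norm_num) (by norm_num), zpow_one, mul_two]
      _ ≤ 2 ^ M := ENNReal.zpow_le_of_le (by norm_num) (hM a (Finset.mem_insert_self _ _))

/-! ### Laminar families and stopping sets. -/

section Laminar

variable {X : Type*}

/-- A finite family of nonempty sets, any two of which are nested or disjoint. -/
def IsLaminar (S : Finset (Set X)) : Prop :=
  (∀ I ∈ S, I.Nonempty) ∧ ∀ I ∈ S, ∀ J ∈ S, I ⊆ J ∨ J ⊆ I ∨ Disjoint I J

theorem IsLaminar.mono {S T : Finset (Set X)} (hS : IsLaminar S) (h : T ⊆ S) : IsLaminar T :=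
  ⟨fun I hI => hS.1 I (h hI), fun I hI J hJ => hS.2 I (h hI) J (h hJ)⟩

theorem IsLaminar.nested {S : Finset (Set X)} (hS : IsLaminar S) {I J : Set X} (hI : I ∈ S)
    (hJ : J ∈ S) {x : X} (hxI : x ∈ I) (hxJ : x ∈ J) : I ⊆ J ∨ J ⊆ I := by
  rcases hS.2 I hI J hJ with h | h | h
  · exact Or.inl h
  · exact Or.inr h
  · exact absurd hxJ (Set.disjoint_left.1 h hxI)

open Classical in
/-- The members of `S` at which `l` is strictly larger than at all larger members. -/
noncomputable def records (S : Finset (Set X)) (l : Set X → ℤ) : Finset (Set X) :=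
  S.filter fun J => ∀ K ∈ S, J ⊂ K → l K < l J

open Classical in
/-- The maximal members of `R` strictly inside `J`. -/
noncomputable def childrenIn (R : Finset (Set X)) (J : Set X) : Finset (Set X) :=
  R.filter fun K => K ⊂ J ∧ ∀ L ∈ R, K ⊂ L → ¬ L ⊂ J

/-- The part of `J` that is not covered by smaller members of `R`. -/
def leftover (R : Finset (Set X)) (J : Set X) : Set X :=
  {x | x ∈ J ∧ ∀ K ∈ R, K ⊂ J → x ∉ K}

theorem records_subset (S : Finset (Set X)) (l : Set X → ℤ) : records S l ⊆ S := by
  classical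
  exact Finset.filter_subset _ _

/-- The records containing `I` form a chain, so a minimal one is least. It is the stopping set
governing `I`, and its level controls that of `I`. -/
theorem exists_record {S : Finset (Set X)} (hS : IsLaminar S) (l : Set X → ℤ) {I : Set X}
    (hI : I ∈ S) : ∃ J ∈ records S l, I ⊆ J ∧ l I ≤ l J ∧ ∀ L ∈ records S l, I ⊆ L → J ⊆ L := by
  classical
  obtain ⟨x, hx⟩ := hS.1 I hI
  obtain ⟨J₀, hJ₀, hmax⟩ := Finset.exists_max_image (S.filter (I ⊆ ·)) l
    ⟨I, Finset.mem_filter.2 ⟨hI, subset_rfl⟩⟩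
  -- A largest set attaining the maximal level above `I` must be a record; the least record `J` lies
  -- inside it, so its level is no smaller.
  obtain ⟨J₁, hJ₁⟩ := ((S.filter (fun K => I ⊆ K ∧ l K = l J₀))).exists_maximal
    ⟨J₀, by simp_all⟩
  have hJ₁m := hJ₁.prop
  simp only [Finset.mem_filter] at hJ₁m hJ₀ hmax
  have hJ₁R : J₁ ∈ records S l := by
    refine Finset.mem_filter.2 ⟨hJ₁m.1, fun K hK hlt => ?_⟩
    have h1 : l K ≤ l J₀ := hmax K ⟨hK, hJ₁m.2.1.trans hlt.subset⟩
    rcases h1.lt_or_eq with h | h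
    · rw [hJ₁m.2.2]; exact h
    · exact absurd (hJ₁.le_of_ge (Finset.mem_filter.2
        ⟨hK, hJ₁m.2.1.trans hlt.subset, h⟩) hlt.subset) hlt.not_subset
  obtain ⟨J, hJ⟩ := ((records S l).filter (I ⊆ ·)).exists_minimal
    ⟨J₁, Finset.mem_filter.2 ⟨hJ₁R, hJ₁m.2.1⟩⟩
  have hJm := Finset.mem_filter.1 hJ.prop
  have hmin : ∀ L ∈ records S l, I ⊆ L → J ⊆ L := by
    intro L hL hIL
    rcases hS.nested (records_subset _ _ hL) (records_subset _ _ hJm.1) (hIL hx) (hJm.2 hx)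
      with h | h
    · exact hJ.le_of_le (Finset.mem_filter.2 ⟨hL, hIL⟩) h
    · exact h
  refine ⟨J, hJm.1, hJm.2, ?_, hmin⟩
  have h2 : l J₁ ≤ l J := by
    rcases (hmin J₁ hJ₁R hJ₁m.2.1).eq_or_ssubset with h | h
    · rw [h]
    · exact ((Finset.mem_filter.1 hJm.1).2 J₁ hJ₁m.1 h).le
  exact (hmax I ⟨hI, subset_rfl⟩).trans (hJ₁m.2.2 ▸ h2)

theorem exists_child {R : Finset (Set X)} {J : Set X} {x : X} (hxJ : x ∈ J)
    (hx : x ∉ leftover R J) : ∃ K ∈ childrenIn R J, x ∈ K := by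
  classical
  have : ∃ K ∈ R, K ⊂ J ∧ x ∈ K := by
    by_contra! h
    exact hx ⟨hxJ, h⟩
  obtain ⟨K₀, hK₀, h⟩ := this
  obtain ⟨K, hK⟩ := (R.filter (fun K => K ⊂ J ∧ x ∈ K)).exists_maximal
    ⟨K₀, Finset.mem_filter.2 ⟨hK₀, h⟩⟩
  have hKm := Finset.mem_filter.1 hK.prop
  refine ⟨K, Finset.mem_filter.2 ⟨hKm.1, hKm.2.1, fun L hL hKL hLJ => ?_⟩, hKm.2.2⟩
  exact hKL.not_subset
    (hK.le_of_ge (Finset.mem_filter.2 ⟨hL, hLJ, hKL.subset hKm.2.2⟩) hKL.subset)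

theorem mem_childrenIn {R : Finset (Set X)} {J K : Set X} :
    K ∈ childrenIn R J ↔ K ∈ R ∧ K ⊂ J ∧ ∀ L ∈ R, K ⊂ L → ¬ L ⊂ J := by
  classical
  exact Finset.mem_filter

theorem IsLaminar.child_unique {R : Finset (Set X)} (hR : IsLaminar R) {J K K' : Set X} {x : X}
    (hK : K ∈ childrenIn R J) (hK' : K' ∈ childrenIn R J) (hx : x ∈ K) (hx' : x ∈ K') :
    K = K' := by
  rw [mem_childrenIn] at hK hK'
  rcases hR.nested hK.1 hK'.1 hx hx' with h | h
  · by_contra hne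
    exact hK.2.2 K' hK'.1 (h.ssubset_of_ne hne) hK'.2.1
  · by_contra hne
    exact hK'.2.2 K hK.1 (h.ssubset_of_ne (Ne.symm hne)) hK.2.1

/-- Two parents of `K` are nested, and the smaller would lie strictly between `K` and the larger.
Hence a double sum over records and their children counts each record at most once. -/
theorem IsLaminar.parent_unique {R : Finset (Set X)} (hR : IsLaminar R) {J J' K : Set X}
    (hJ : J ∈ R) (hJ' : J' ∈ R)
    (hK : K ∈ childrenIn R J) (hK' : K ∈ childrenIn R J') : J = J' := by
  rw [mem_childrenIn] at hK hK'
  obtain ⟨x, hx⟩ := hR.1 K hK.1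
  by_contra hne
  rcases hR.nested hJ hJ' (hK.2.1.subset hx) (hK'.2.1.subset hx) with h | h
  · exact hK'.2.2 J hJ hK.2.1 (h.ssubset_of_ne hne)
  · exact hK.2.2 J' hJ' hK'.2.1 (h.ssubset_of_ne (Ne.symm hne))

theorem IsLaminar.leftover_unique {R : Finset (Set X)} (hR : IsLaminar R) {J J' : Set X}
    (hJ : J ∈ R) (hJ' : J' ∈ R) {x : X} (hx : x ∈ leftover R J) (hx' : x ∈ leftover R J') :
    J = J' := by
  by_contra hne
  rcases hR.nested hJ hJ' hx.1 hx'.1 with h | h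
  · exact hx'.2 J hJ (h.ssubset_of_ne hne) hx.1
  · exact hx.2 J' hJ' (h.ssubset_of_ne (Ne.symm hne)) hx'.1

open Classical in
/-- On the chain of records through a point, numbers of size `2 ^ l` grow geometrically. -/
theorem sq_sum_records_le {S : Finset (Set X)} (hS : IsLaminar S) {l : Set X → ℤ}
    {a : Set X → ℝ≥0∞}
    (hl : ∀ I ∈ S, (2 : ℝ≥0∞) ^ l I ≤ a I ∧ a I < 2 ^ (l I + 1)) (x : X) :
    (∑ J ∈ records S l, J.indicator (fun _ => a J) x) ^ 2 ≤
      16 * ∑ J ∈ records S l, J.indicator (fun _ => a J ^ 2) x := by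
  have e : ∀ b : Set X → ℝ≥0∞, ∑ J ∈ records S l, J.indicator (fun _ => b J) x =
      ∑ J ∈ (records S l).filter (x ∈ ·), b J := by
    intro b
    rw [Finset.sum_filter]
    exact Finset.sum_congr rfl fun J _ => by simp [Set.indicator]
  rw [e, e]
  set t := (records S l).filter (x ∈ ·) with ht
  rcases t.eq_empty_or_nonempty with h | h
  · simp [h]
  obtain ⟨K, hK, hmax⟩ := Finset.exists_max_image t l h
  have htS : ∀ J ∈ t, J ∈ S := fun J hJ => records_subset _ _ (Finset.mem_filter.1 hJ).1
  have hinj : Set.InjOn l t := by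
    intro J hJ J' hJ' hll
    have h1 := Finset.mem_filter.1 hJ
    have h2 := Finset.mem_filter.1 hJ'
    by_contra hne
    rcases hS.nested (htS J hJ) (htS J' hJ') h1.2 h2.2 with h | h
    · exact absurd ((Finset.mem_filter.1 h1.1).2 J' (htS J' hJ') (h.ssubset_of_ne hne))
        (by rw [hll]; exact lt_irrefl _)
    · exact absurd ((Finset.mem_filter.1 h2.1).2 J (htS J hJ) (h.ssubset_of_ne (Ne.symm hne)))
        (by rw [hll]; exact lt_irrefl _)
  have two : ∀ z : ℤ, (2 : ℝ≥0∞) ^ (z + 1) = 2 ^ z * 2 := fun z => by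
    rw [ENNReal.zpow_add (by norm_num) (by norm_num), zpow_one]
  -- The `a J` are within a factor 2 of distinct powers of two, which add up to at most twice the
  -- largest; the two factors make 4.
  have hsum : ∑ J ∈ t, a J ≤ 4 * a K := by
    calc ∑ J ∈ t, a J ≤ ∑ J ∈ t, (2 : ℝ≥0∞) ^ l J * 2 :=
          Finset.sum_le_sum fun J hJ => by rw [← two]; exact (hl J (htS J hJ)).2.le
      _ = (∑ z ∈ t.image l, (2 : ℝ≥0∞) ^ z) * 2 := by
        rw [← Finset.sum_mul, Finset.sum_image hinj]
      _ ≤ 2 ^ (l K + 1) * 2 := by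
        gcongr
        refine sum_two_zpow_le _ _ fun z hz => ?_
        obtain ⟨J, hJ, rfl⟩ := Finset.mem_image.1 hz
        exact Int.lt_add_one_iff.2 (hmax J hJ)
      _ = 4 * 2 ^ l K := by rw [two]; ring
      _ ≤ 4 * a K := by gcongr; exact (hl K (htS K hK)).1
  calc (∑ J ∈ t, a J) ^ 2 ≤ (4 * a K) ^ 2 := by gcongr
    _ = 16 * a K ^ 2 := by ring
    _ ≤ 16 * ∑ J ∈ t, a J ^ 2 := by
      gcongr
      exact Finset.single_le_sum (f := fun J => a J ^ 2) (fun _ _ => zero_le) hK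

end Laminar

theorem indicator_sq {X : Type*} (J : Set X) (f : X → ℝ≥0∞) (x : X) :
    (J.indicator f x) ^ 2 = J.indicator (fun y => f y ^ 2) x := by
  by_cases h : x ∈ J <;> simp [h]

/-! ### Two-weight estimates on a laminar family. -/

section TwoWeight

variable {X : Type*} [MeasurableSpace X]

theorem measurable_indicator_const {J : Set X} (hJ : MeasurableSet J) (a : ℝ≥0∞) :
    Measurable (J.indicator fun _ => a) := measurable_const.indicator hJ

/-- The Carleson embedding for the records of the averages of `F`. -/
theorem sum_records_avg_sq_le {S : Finset (Set X)} (hS : IsLaminar S)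
    (hm : ∀ I ∈ S, MeasurableSet I) {σ : Measure X} (h0 : ∀ I ∈ S, σ I ≠ 0)
    (h1 : ∀ I ∈ S, σ I ≠ ∞) {F : X → ℝ≥0∞} (hF : Measurable F)
    {l : Set X → ℤ}
    (hl : ∀ I ∈ S, (2 : ℝ≥0∞) ^ l I ≤ (∫⁻ x in I, F x ∂σ) / σ I ∧
      (∫⁻ x in I, F x ∂σ) / σ I < 2 ^ (l I + 1)) :
    ∑ J ∈ records S l, ((∫⁻ x in J, F x ∂σ) / σ J) ^ 2 * σ J ≤ 64 * ∫⁻ x, F x ^ 2 ∂σ := by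
  classical
  set a : Set X → ℝ≥0∞ := fun I => (∫⁻ x in I, F x ∂σ) / σ I with ha
  set Z := ∑ J ∈ records S l, a J ^ 2 * σ J with hZ
  have hRS := records_subset S l
  have haT : ∀ I ∈ S, a I ≠ ∞ := fun I hI => (hl I hI).2.ne_top
  have hZT : Z ≠ ∞ := by
    refine (ENNReal.sum_lt_top.2 fun J hJ => ?_).ne
    exact ENNReal.mul_lt_top (ENNReal.pow_lt_top (haT J (hRS hJ)).lt_top) (h1 J (hRS hJ)).lt_top
  -- Self-improvement: one copy of the finite quantity `Z` is absorbed at the end.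
  have key : 2 * Z ≤ 64 * ∫⁻ x, F x ^ 2 ∂σ + Z := by
    calc 2 * Z = 2 * ∑ J ∈ records S l, a J * ∫⁻ x in J, F x ∂σ := by
          rw [hZ]
          congr 1
          refine Finset.sum_congr rfl fun J hJ => ?_
          rw [sq, mul_assoc]
          congr 1
          exact ENNReal.div_mul_cancel (h0 J (hRS hJ)) (h1 J (hRS hJ))
      _ = ∫⁻ x, 2 * (F x * ∑ J ∈ records S l, J.indicator (fun _ => a J) x) ∂σ := by
          have hmJ : ∀ J ∈ records S l, Measurable fun x => F x * J.indicator (fun _ => a J) x :=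
            fun J hJ => hF.mul (measurable_indicator_const (hm J (hRS hJ)) _)
          rw [lintegral_const_mul' _ _ (by norm_num)]
          congr 1
          simp_rw [Finset.mul_sum]
          rw [lintegral_finsetSum _ hmJ]
          refine Finset.sum_congr rfl fun J hJ => ?_
          rw [← lintegral_indicator (hm J (hRS hJ)),
            ← lintegral_const_mul _ (hF.indicator (hm J (hRS hJ)))]
          congr 2 with x
          by_cases hx : x ∈ J <;> simp [hx, mul_comm]
      _ ≤ ∫⁻ x, (64 * F x ^ 2 + ∑ J ∈ records S l, J.indicator (fun _ => a J ^ 2) x) ∂σ := by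
          refine lintegral_mono fun x => ?_
          have h := sq_sum_records_le hS hl x
          set Φ := ∑ J ∈ records S l, J.indicator (fun _ => a J) x
          set Ψ := ∑ J ∈ records S l, J.indicator (fun _ => a J ^ 2) x
          -- If `Φ ≤ 32 F`, the first summand suffices; otherwise `32 F Φ ≤ Φ² ≤ 16 Ψ` gives `2 F Φ
          -- ≤ Ψ`.
          rcases le_total Φ (32 * F x) with h' | h'
          · calc 2 * (F x * Φ) ≤ 2 * (F x * (32 * F x)) := by gcongr
              _ = 64 * F x ^ 2 := by ring
              _ ≤ _ := le_self_add
          · have : 16 * (2 * (F x * Φ)) ≤ 16 * Ψ := by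
              calc 16 * (2 * (F x * Φ)) = (32 * F x) * Φ := by ring
                _ ≤ Φ * Φ := by gcongr
                _ = Φ ^ 2 := (sq _).symm
                _ ≤ _ := h
            exact ((ENNReal.mul_le_mul_iff_right (by norm_num) (by norm_num)).1 this).trans
              le_add_self
      _ = _ := by
          rw [lintegral_add_left ((hF.pow_const 2).const_mul _),
            lintegral_const_mul _ (hF.pow_const 2),
            lintegral_finsetSum _ fun J hJ => measurable_indicator_const (hm J (hRS hJ)) _]
          congr 1
          refine Finset.sum_congr rfl fun J hJ => ?_
          rw [lintegral_indicator_const (hm J (hRS hJ))]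
  rw [two_mul] at key
  exact (ENNReal.add_le_add_iff_right hZT).1 key

open Classical in
/-- Half of the two weight theorem for positive dyadic operators: the part of the bilinear form
where the averages of `F` dominate those of `G`. -/
theorem sum_le_of_dominated {S : Finset (Set X)} (hS : IsLaminar S)
    (hm : ∀ I ∈ S, MeasurableSet I) {σ ω : Measure X} (h0 : ∀ I ∈ S, σ I ≠ 0)
    (h1 : ∀ I ∈ S, σ I ≠ ∞) (k0 : ∀ I ∈ S, ω I ≠ 0) (k1 : ∀ I ∈ S, ω I ≠ ∞)
    {F G : X → ℝ≥0∞} (hF : Measurable F) (hG : Measurable G)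
    (hF1 : ∀ I ∈ S, ∫⁻ x in I, F x ∂σ ≠ ∞)
    (hdom : ∀ I ∈ S, ((∫⁻ x in I, G x ∂ω) / ω I) ^ 2 * ω I ≤
      ((∫⁻ x in I, F x ∂σ) / σ I) ^ 2 * σ I)
    {c : Set X → ℝ≥0∞}
    (htest : ∀ J ∈ S, ∫⁻ x, (∑ I ∈ S.filter (· ⊆ J), I.indicator (fun _ => c I) x) ^ 2 ∂ω ≤
      2 * σ J) :
    ∑ I ∈ S, c I * ((∫⁻ x in I, F x ∂σ) / σ I) * ∫⁻ x in I, G x ∂ω ≤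
      400 * (∫⁻ x, F x ^ 2 ∂σ + ∫⁻ x, G x ^ 2 ∂ω) := by
  set a : Set X → ℝ≥0∞ := fun I => (∫⁻ x in I, F x ∂σ) / σ I with ha
  set b : Set X → ℝ≥0∞ := fun I => (∫⁻ x in I, G x ∂ω) / ω I with hb
  -- Sets with `∫_I F dσ = 0` contribute nothing, and removing them only shrinks the testing sums.
  -- On the others the average is positive and so has a dyadic level.
  wlog hF0 : ∀ I ∈ S, ∫⁻ x in I, F x ∂σ ≠ 0 generalizing S
  · have hsub : S.filter (fun I => ∫⁻ x in I, F x ∂σ ≠ 0) ⊆ S := Finset.filter_subset _ _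
    have h := this (S := S.filter fun I => ∫⁻ x in I, F x ∂σ ≠ 0) (hS.mono hsub)
      (fun I hI => hm I (hsub hI)) (fun I hI => h0 I (hsub hI)) (fun I hI => h1 I (hsub hI))
      (fun I hI => k0 I (hsub hI)) (fun I hI => k1 I (hsub hI)) (fun I hI => hF1 I (hsub hI))
      (fun I hI => hdom I (hsub hI))
      (fun J hJ => (lintegral_mono fun x => by
        gcongr).trans (htest J (hsub hJ)))
      (fun I hI => (Finset.mem_filter.1 hI).2)
    refine le_trans (le_of_eq ?_) h
    rw [Finset.sum_filter_of_ne]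
    intro I hI hne hz
    apply hne
    simp [hz]
  have hlex : ∀ I, ∃ z : ℤ, I ∈ S → (2 : ℝ≥0∞) ^ z ≤ a I ∧ a I < 2 ^ (z + 1) := by
    intro I
    by_cases hI : I ∈ S
    · obtain ⟨z, hz⟩ := ENNReal.exists_mem_Ico_zpow (x := a I) (y := 2)
        (ENNReal.div_ne_zero.2 ⟨hF0 I hI, h1 I hI⟩)
        (ENNReal.div_ne_top (hF1 I hI) (h0 I hI)) (by norm_num) (by norm_num)
      exact ⟨z, fun _ => hz⟩
    · exact ⟨0, fun h => absurd h hI⟩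
  choose l hl using hlex
  set R := records S l with hRdef
  have hRS : R ⊆ S := records_subset S l
  have hR : IsLaminar R := hS.mono hRS
  have hZ : ∑ J ∈ R, a J ^ 2 * σ J ≤ 64 * ∫⁻ x, F x ^ 2 ∂σ :=
    sum_records_avg_sq_le hS hm h0 h1 hF hl
  have hπex : ∀ I, ∃ J, I ∈ S → J ∈ R ∧ I ⊆ J ∧ l I ≤ l J ∧ ∀ L ∈ R, I ⊆ L → J ⊆ L := by
    intro I
    by_cases hI : I ∈ S
    · obtain ⟨J, h⟩ := exists_record hS l hI
      exact ⟨J, fun _ => h⟩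
    · exact ⟨∅, fun h => absurd h hI⟩
  choose π hπ using hπex
  have haπ : ∀ I ∈ S, a I ≤ 2 * a (π I) := by
    intro I hI
    obtain ⟨h1, -, h3, -⟩ := hπ I hI
    have one_le : (1 : ℝ≥0∞) ≤ 2 := by norm_num
    calc a I ≤ 2 ^ (l I + 1) := (hl I hI).2.le
      _ = 2 * 2 ^ l I := by
        rw [ENNReal.zpow_add (by norm_num) (by norm_num), zpow_one, mul_comm]
      _ ≤ 2 * 2 ^ l (π I) := by
        exact mul_le_mul_right (ENNReal.zpow_le_of_le one_le h3) _
      _ ≤ 2 * a (π I) := by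
        gcongr
        exact (hl _ (hRS h1)).1
  have hchR : ∀ J, childrenIn R J ⊆ R := fun J K hK => (mem_childrenIn.1 hK).1
  have hlm : ∀ J ∈ R, MeasurableSet (leftover R J) := by
    intro J hJ
    have : leftover R J = J \ ⋃ K ∈ R.filter (· ⊂ J), K := by
      ext x
      simp [leftover]
    rw [this]
    exact (hm J (hRS hJ)).diff (Finset.measurableSet_biUnion _ fun K hK =>
      hm K (hRS (Finset.mem_filter.1 hK).1))
  -- `H J` is `G` averaged over each child of `J` and unchanged off the children; `T J` is the part
  -- of the operator carried by the corona of `J`.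
  set H : Set X → X → ℝ≥0∞ := fun J x => (leftover R J).indicator G x +
    ∑ K ∈ childrenIn R J, K.indicator (fun _ => b K) x with hH
  set T : Set X → X → ℝ≥0∞ := fun J x => ∑ I ∈ S.filter (fun I => π I = J),
    I.indicator (fun _ => c I) x with hT
  have hHm : ∀ J ∈ R, Measurable (H J) := fun J hJ =>
    (hG.indicator (hlm J hJ)).add (Finset.measurable_fun_sum _ fun K hK =>
      measurable_indicator_const (hm K (hRS (hchR J hK))) _)
  have hTm : ∀ J, Measurable (T J) := fun J =>
    Finset.measurable_fun_sum _ fun I hI =>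
      measurable_indicator_const (hm I (Finset.mem_filter.1 hI).1) _
  -- No child `K` of `J = π I` contains `I`, since `J` is the least record above `I`. So `K` lies in
  -- `I` or misses it, and averaging over `K` preserves the integral over `I`.
  have hrepl : ∀ I ∈ S, ∫⁻ x in I, G x ∂ω ≤ ∫⁻ x in I, H (π I) x ∂ω := by
    intro I hI
    obtain ⟨hJ, hIJ, -, hmin⟩ := hπ I hI
    set J := π I
    have hpt : ∀ x ∈ I, G x ≤ (leftover R J).indicator G x +
        ∑ K ∈ childrenIn R J, K.indicator G x := by
      intro x hx
      by_cases hxl : x ∈ leftover R J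
      · rw [Set.indicator_of_mem hxl]; exact le_self_add
      · obtain ⟨K, hK, hxK⟩ := exists_child (hIJ hx) hxl
        calc G x = K.indicator G x := (Set.indicator_of_mem hxK _).symm
          _ ≤ ∑ K ∈ childrenIn R J, K.indicator G x :=
            Finset.single_le_sum (f := fun K => K.indicator G x) (fun _ _ => zero_le) hK
          _ ≤ _ := le_add_self
    calc ∫⁻ x in I, G x ∂ω ≤ ∫⁻ x in I, ((leftover R J).indicator G x +
            ∑ K ∈ childrenIn R J, K.indicator G x) ∂ω :=
          setLIntegral_mono' (hm I hI) hpt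
      _ = ∫⁻ x in I, (leftover R J).indicator G x ∂ω +
            ∑ K ∈ childrenIn R J, ∫⁻ x in I, K.indicator G x ∂ω := by
          rw [lintegral_add_left (hG.indicator (hlm J hJ)), lintegral_finsetSum _ fun K hK =>
            hG.indicator (hm K (hRS (hchR J hK)))]
      _ ≤ ∫⁻ x in I, (leftover R J).indicator G x ∂ω +
            ∑ K ∈ childrenIn R J, ∫⁻ x in I, K.indicator (fun _ => b K) x ∂ω := by
          refine add_le_add le_rfl (Finset.sum_le_sum fun K hK => ?_)
          have hKS := hRS (hchR J hK)
          rw [setLIntegral_indicator (hm K hKS), setLIntegral_indicator (hm K hKS)]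
          rcases hS.2 K hKS I hI with h | h | h
          · rw [Set.inter_eq_left.2 h, setLIntegral_const]
            exact (ENNReal.div_mul_cancel (k0 K hKS) (k1 K hKS)).ge
          · exact absurd (hmin K (hchR J hK) h) (mem_childrenIn.1 hK).2.1.not_subset
          · rw [h.inter_eq]; simp
      _ = _ := by
          rw [hH, lintegral_add_left (hG.indicator (hlm J hJ)), lintegral_finsetSum _ fun K hK =>
            measurable_indicator_const (hm K (hRS (hchR J hK))) _]
  -- The leftover and the children of `J` are pairwise disjoint, so there are no cross terms.
  have hHsq : ∀ J x, H J x ^ 2 = (leftover R J).indicator (fun y => G y ^ 2) x +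
      ∑ K ∈ childrenIn R J, K.indicator (fun _ => b K ^ 2) x := by
    intro J x
    by_cases hx : ∃ K ∈ childrenIn R J, x ∈ K
    · obtain ⟨K, hK, hxK⟩ := hx
      have hnl : x ∉ leftover R J := fun h =>
        h.2 K (hchR J hK) (mem_childrenIn.1 hK).2.1 hxK
      have hz : ∀ K' ∈ childrenIn R J, K' ≠ K → x ∉ K' := fun K' hK' hne hx' =>
        hne (hR.child_unique hK' hK hx' hxK)
      simp only [hH]
      rw [Finset.sum_eq_single_of_mem K hK fun K' hK' hne =>
          Set.indicator_of_notMem (hz K' hK' hne) _,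
        Finset.sum_eq_single_of_mem K hK fun K' hK' hne =>
          Set.indicator_of_notMem (hz K' hK' hne) _]
      simp [hnl, hxK]
    · push Not at hx
      simp only [hH]
      rw [Finset.sum_eq_zero fun K hK => Set.indicator_of_notMem (hx K hK) _,
        Finset.sum_eq_zero fun K hK => Set.indicator_of_notMem (hx K hK) _]
      simp [indicator_sq]
  have hHint : ∀ J ∈ R, ∫⁻ x, H J x ^ 2 ∂ω = ∫⁻ x, (leftover R J).indicator (fun y => G y ^ 2) x ∂ω
      + ∑ K ∈ childrenIn R J, b K ^ 2 * ω K := by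
    intro J hJ
    simp_rw [hHsq]
    rw [lintegral_add_left ((hG.pow_const 2).indicator (hlm J hJ)), lintegral_finsetSum _ fun K hK =>
            measurable_indicator_const (hm K (hRS (hchR J hK))) _]
    congr 1
    exact Finset.sum_congr rfl fun K hK => lintegral_indicator_const (hm K (hRS (hchR J hK))) _
  have hleft : ∑ J ∈ R, ∫⁻ x, (leftover R J).indicator (fun y => G y ^ 2) x ∂ω ≤
      ∫⁻ x, G x ^ 2 ∂ω := by
    rw [← lintegral_finsetSum _ fun J hJ => (hG.pow_const 2).indicator (hlm J hJ)]
    refine lintegral_mono fun x => ?_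
    by_cases hx : ∃ J ∈ R, x ∈ leftover R J
    · obtain ⟨J, hJ, hxJ⟩ := hx
      rw [Finset.sum_eq_single_of_mem J hJ fun J' hJ' hne => Set.indicator_of_notMem
        (fun h => hne (hR.leftover_unique hJ' hJ h hxJ)) _]
      exact Set.indicator_le_self _ _ _
    · push Not at hx
      rw [Finset.sum_eq_zero fun K hK => Set.indicator_of_notMem (hx K hK) _]
      exact zero_le
  -- This is where domination enters: the energy of `G` on the children is paid for by `F`, with no
  -- stopping construction for `G`.
  have hkids : ∑ J ∈ R, ∑ K ∈ childrenIn R J, b K ^ 2 * ω K ≤ ∑ J ∈ R, a J ^ 2 * σ J := by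
    rw [← Finset.sum_biUnion]
    · calc ∑ K ∈ R.biUnion (childrenIn R), b K ^ 2 * ω K ≤ ∑ K ∈ R, b K ^ 2 * ω K :=
          Finset.sum_le_sum_of_subset (Finset.biUnion_subset.2 fun J _ => hchR J)
        _ ≤ _ := Finset.sum_le_sum fun K hK => hdom K (hRS hK)
    · intro J hJ J' hJ' hne
      refine Finset.disjoint_left.2 fun K hK hK' => hne (hR.parent_unique hJ hJ' hK hK')
  have hTint : ∀ J ∈ R, ∫⁻ x, T J x ^ 2 ∂ω ≤ 2 * σ J := by
    intro J hJ
    refine (lintegral_mono fun x => ?_).trans (htest J (hRS hJ))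
    refine pow_le_pow_left' (Finset.sum_le_sum_of_subset fun I hI => ?_) 2
    rw [Finset.mem_filter] at hI ⊢
    exact ⟨hI.1, hI.2 ▸ (hπ I hI.1).2.1⟩
  have hcorona : ∀ J ∈ R, ∑ I ∈ S.filter (fun I => π I = J), c I * a I * ∫⁻ x in I, G x ∂ω ≤
      4 * (a J ^ 2 * σ J) + 2 * ∫⁻ x, H J x ^ 2 ∂ω := by
    intro J hJ
    calc ∑ I ∈ S.filter (fun I => π I = J), c I * a I * ∫⁻ x in I, G x ∂ω
        ≤ ∑ I ∈ S.filter (fun I => π I = J), c I * (2 * a J) * ∫⁻ x in I, H J x ∂ω := by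
          refine Finset.sum_le_sum fun I hI => ?_
          obtain ⟨hIS, rfl⟩ := Finset.mem_filter.1 hI
          exact mul_le_mul' (mul_le_mul_right (haπ I hIS) _) (hrepl I hIS)
      _ = ∫⁻ x, 2 * (a J * T J x * H J x) ∂ω := by
          have hmI : ∀ I ∈ S.filter (fun I => π I = J), Measurable fun x =>
              a J * I.indicator (fun _ => c I) x * H J x := fun I hI =>
            ((measurable_indicator_const (hm I (Finset.mem_filter.1 hI).1) _).const_mul _).mul
              (hHm J hJ)
          rw [lintegral_const_mul' _ _ (by norm_num)]
          simp_rw [hT, Finset.mul_sum, Finset.sum_mul]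
          rw [lintegral_finsetSum _ hmI, Finset.mul_sum]
          refine Finset.sum_congr rfl fun I hI => ?_
          have hI := (Finset.mem_filter.1 hI).1
          rw [← lintegral_indicator (hm I hI),
            show c I * (2 * a J) = 2 * (c I * a J) by ring, mul_assoc,
            ← lintegral_const_mul _ ((hHm J hJ).indicator (hm I hI))]
          congr 2 with x
          by_cases hx : x ∈ I <;> simp [hx, mul_comm, mul_left_comm]
      _ ≤ ∫⁻ x, 2 * (a J ^ 2 * T J x ^ 2 + H J x ^ 2) ∂ω := by
          refine lintegral_mono fun x => ?_
          gcongr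
          rw [← mul_pow]
          exact ENNReal.mul_le_sq_add_sq _ _
      _ = 2 * (a J ^ 2 * ∫⁻ x, T J x ^ 2 ∂ω) + 2 * ∫⁻ x, H J x ^ 2 ∂ω := by
          have m1 := (hTm J).pow_const 2
          have m2 := (hHm J hJ).pow_const 2
          rw [lintegral_const_mul' _ _ (by norm_num),
            lintegral_add_left (m1.const_mul _), lintegral_const_mul _ m1, mul_add]
      _ ≤ 2 * (a J ^ 2 * (2 * σ J)) + 2 * ∫⁻ x, H J x ^ 2 ∂ω := by
          gcongr
          exact hTint J hJ
      _ = _ := by ring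
  set NF := ∫⁻ x, F x ^ 2 ∂σ
  set NG := ∫⁻ x, G x ^ 2 ∂ω
  set Z := ∑ J ∈ R, a J ^ 2 * σ J with hZdef
  calc ∑ I ∈ S, c I * a I * ∫⁻ x in I, G x ∂ω
      = ∑ J ∈ R, ∑ I ∈ S.filter (fun I => π I = J), c I * a I * ∫⁻ x in I, G x ∂ω :=
        (Finset.sum_fiberwise_of_maps_to (fun I hI => (hπ I hI).1) _).symm
    _ ≤ ∑ J ∈ R, (4 * (a J ^ 2 * σ J) + 2 * ∫⁻ x, H J x ^ 2 ∂ω) := Finset.sum_le_sum hcorona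
    _ = 4 * Z + 2 * ∑ J ∈ R, ∫⁻ x, H J x ^ 2 ∂ω := by
        rw [Finset.sum_add_distrib, ← Finset.mul_sum, ← Finset.mul_sum]
    _ ≤ 4 * Z + 2 * (NG + Z) := by
        gcongr
        rw [Finset.sum_congr rfl hHint, Finset.sum_add_distrib]
        exact add_le_add hleft hkids
    _ = 6 * Z + 2 * NG := by ring
    _ ≤ 6 * (64 * NF) + 400 * NG := by
        gcongr
        norm_num
    _ = 384 * NF + 400 * NG := by ring
    _ ≤ 400 * NF + 400 * NG := by
        gcongr
        norm_num
    _ = _ := by ring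

open Classical in
/-- The testing condition follows from the two Carleson conditions. -/
theorem lintegral_sq_le_of_carleson {S : Finset (Set X)} (hS : IsLaminar S)
    (hm : ∀ I ∈ S, MeasurableSet I) {ω : Measure X} {c t : Set X → ℝ≥0∞}
    (hc : ∀ J ∈ S, ∑ I ∈ S.filter (· ⊆ J), c I * ω I ≤ t J) (J : Set X) :
    ∫⁻ x, (∑ I ∈ S.filter (· ⊆ J), I.indicator (fun _ => c I) x) ^ 2 ∂ω ≤
      2 * ∑ I ∈ S.filter (· ⊆ J), c I * t I := by
  set S' := S.filter (· ⊆ J) with hS'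
  have hsub : S' ⊆ S := Finset.filter_subset _ _
  -- Two members through `x` are nested; each product in the expanded square is charged to the
  -- larger set, and symmetry gives the factor 2.
  have hpt : ∀ x, (∑ I ∈ S', I.indicator (fun _ => c I) x) ^ 2 ≤
      2 * ∑ I ∈ S', ∑ K ∈ S.filter (· ⊆ I), K.indicator (fun _ => c I * c K) x := by
    intro x
    have hle : ∀ I ∈ S', ∀ K ∈ S', I.indicator (fun _ => c I) x * K.indicator (fun _ => c K) x ≤
        (if K ⊆ I then K.indicator (fun _ => c I * c K) x else 0) +
        (if I ⊆ K then I.indicator (fun _ => c K * c I) x else 0) := by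
      intro I hI K hK
      by_cases hxI : x ∈ I
      · by_cases hxK : x ∈ K
        · rcases hS.nested (hsub hI) (hsub hK) hxI hxK with h | h
          · simp [hxI, hxK, h, mul_comm]
          · simp [hxI, hxK, h]
        · simp [hxK]
      · simp [hxI]
    have hsum : ∀ I ∈ S', ∑ K ∈ S', (if K ⊆ I then K.indicator (fun _ => c I * c K) x else 0) ≤
        ∑ K ∈ S.filter (· ⊆ I), K.indicator (fun _ => c I * c K) x := by
      intro I hI
      rw [← Finset.sum_filter]
      gcongr
    calc (∑ I ∈ S', I.indicator (fun _ => c I) x) ^ 2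
        = ∑ I ∈ S', ∑ K ∈ S', I.indicator (fun _ => c I) x * K.indicator (fun _ => c K) x := by
          rw [sq, Finset.sum_mul_sum]
      _ ≤ ∑ I ∈ S', ∑ K ∈ S', ((if K ⊆ I then K.indicator (fun _ => c I * c K) x else 0) +
        (if I ⊆ K then I.indicator (fun _ => c K * c I) x else 0)) :=
          Finset.sum_le_sum fun I hI => Finset.sum_le_sum fun K hK => hle I hI K hK
      _ = 2 * ∑ I ∈ S', ∑ K ∈ S', (if K ⊆ I then K.indicator (fun _ => c I * c K) x else 0) := by
          simp_rw [Finset.sum_add_distrib]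
          rw [two_mul]
          congr 1
          exact Finset.sum_comm
      _ ≤ _ := by
          gcongr with I hI
          exact hsum I hI
  have hmeas : ∀ I, Measurable fun x => ∑ K ∈ S.filter (· ⊆ I),
      K.indicator (fun _ => c I * c K) x := fun I =>
    Finset.measurable_fun_sum _ fun K hK =>
      measurable_indicator_const (hm K (Finset.mem_filter.1 hK).1) _
  calc ∫⁻ x, (∑ I ∈ S', I.indicator (fun _ => c I) x) ^ 2 ∂ω
      ≤ ∫⁻ x, 2 * ∑ I ∈ S', ∑ K ∈ S.filter (· ⊆ I), K.indicator (fun _ => c I * c K) x ∂ω :=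
        lintegral_mono hpt
    _ = 2 * ∑ I ∈ S', ∑ K ∈ S.filter (· ⊆ I), c I * (c K * ω K) := by
        rw [lintegral_const_mul _ (Finset.measurable_fun_sum _ fun I _ => hmeas I),
          lintegral_finsetSum _ fun I _ => hmeas I]
        congr 1
        refine Finset.sum_congr rfl fun I _ => ?_
        rw [lintegral_finsetSum _ fun K hK =>
          measurable_indicator_const (hm K (Finset.mem_filter.1 hK).1) _]
        refine Finset.sum_congr rfl fun K hK => ?_
        rw [lintegral_indicator_const (hm K (Finset.mem_filter.1 hK).1), mul_assoc]
    _ ≤ _ := by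
        simp_rw [← Finset.mul_sum]
        gcongr with I hI
        exact hc I (hsub hI)

open Classical in
/-- The bilinear embedding theorem for finite laminar families. -/
theorem bilinear_embedding_laminar {S : Finset (Set X)} (hS : IsLaminar S)
    (hm : ∀ I ∈ S, MeasurableSet I) {μ σ ω : Measure X}
    (m0 : ∀ I ∈ S, μ I ≠ 0) (m1 : ∀ I ∈ S, μ I ≠ ∞)
    (h0 : ∀ I ∈ S, σ I ≠ 0) (h1 : ∀ I ∈ S, σ I ≠ ∞) (k0 : ∀ I ∈ S, ω I ≠ 0)
    (k1 : ∀ I ∈ S, ω I ≠ ∞) {F G : X → ℝ≥0∞} (hF : Measurable F) (hG : Measurable G)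
    (hF1 : ∀ I ∈ S, ∫⁻ x in I, F x ∂σ ≠ ∞) (hG1 : ∀ I ∈ S, ∫⁻ x in I, G x ∂ω ≠ ∞)
    {a : Set X → ℝ≥0∞}
    (hω : ∀ J ∈ S, ∑ I ∈ S.filter (· ⊆ J), a I * ω I ≤ ω J)
    (hσ : ∀ J ∈ S, ∑ I ∈ S.filter (· ⊆ J), a I * σ I ≤ σ J)
    (hσω : ∀ J ∈ S, ∑ I ∈ S.filter (· ⊆ J), a I * σ I * ω I / μ I ≤ μ J) :
    ∑ I ∈ S, a I * (∫⁻ x in I, F x ∂σ) * (∫⁻ x in I, G x ∂ω) / μ I ≤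
      800 * (∫⁻ x, F x ^ 2 ∂σ + ∫⁻ x, G x ^ 2 ∂ω) := by
  set P : Set X → Prop := fun I => ((∫⁻ x in I, G x ∂ω) / ω I) ^ 2 * ω I ≤
      ((∫⁻ x in I, F x ∂σ) / σ I) ^ 2 * σ I with hP
  -- With coefficients `a σ / μ`, the bilinear Carleson condition bounds the inner sums by `μ I`;
  -- this cancels the denominator and leaves the linear condition for `σ`.
  have test1 : ∀ J ∈ S, ∫⁻ x, (∑ I ∈ S.filter (· ⊆ J),
      I.indicator (fun _ => a I * σ I / μ I) x) ^ 2 ∂ω ≤ 2 * σ J := by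
    intro J hJ
    refine (lintegral_sq_le_of_carleson hS hm (t := μ) (fun J hJ => ?_) J).trans ?_
    · refine le_trans (le_of_eq (Finset.sum_congr rfl fun I _ => ?_)) (hσω J hJ)
      simp only [div_eq_mul_inv]; ring
    · gcongr
      refine le_trans (le_of_eq (Finset.sum_congr rfl fun I hI => ?_)) (hσ J hJ)
      have hI := (Finset.mem_filter.1 hI).1
      exact ENNReal.div_mul_cancel (m0 I hI) (m1 I hI)
  have test2 : ∀ J ∈ S, ∫⁻ x, (∑ I ∈ S.filter (· ⊆ J),
      I.indicator (fun _ => a I * ω I / μ I) x) ^ 2 ∂σ ≤ 2 * ω J := by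
    intro J hJ
    refine (lintegral_sq_le_of_carleson hS hm (t := μ) (fun J hJ => ?_) J).trans ?_
    · refine le_trans (le_of_eq (Finset.sum_congr rfl fun I _ => ?_)) (hσω J hJ)
      simp only [div_eq_mul_inv]; ring
    · gcongr
      refine le_trans (le_of_eq (Finset.sum_congr rfl fun I hI => ?_)) (hω J hJ)
      have hI := (Finset.mem_filter.1 hI).1
      exact ENNReal.div_mul_cancel (m0 I hI) (m1 I hI)
  have hsA : S.filter P ⊆ S := Finset.filter_subset _ _
  have hsB : S.filter (fun I => ¬ P I) ⊆ S := Finset.filter_subset _ _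
  have hA := sum_le_of_dominated (hS.mono hsA) (fun I hI => hm I (hsA hI))
    (fun I hI => h0 I (hsA hI)) (fun I hI => h1 I (hsA hI)) (fun I hI => k0 I (hsA hI))
    (fun I hI => k1 I (hsA hI)) hF hG (fun I hI => hF1 I (hsA hI))
    (fun I hI => (Finset.mem_filter.1 hI).2) (c := fun I => a I * σ I / μ I)
    (fun J hJ => (lintegral_mono fun x => by gcongr).trans (test1 J (hsA hJ)))
  -- Where `P` fails, `G` dominates, and the pairs `(σ, F)` and `(ω, G)` exchange roles.
  have hB := sum_le_of_dominated (hS.mono hsB) (fun I hI => hm I (hsB hI))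
    (fun I hI => k0 I (hsB hI)) (fun I hI => k1 I (hsB hI)) (fun I hI => h0 I (hsB hI))
    (fun I hI => h1 I (hsB hI)) hG hF (fun I hI => hG1 I (hsB hI))
    (fun I hI => (not_le.1 (Finset.mem_filter.1 hI).2).le) (c := fun I => a I * ω I / μ I)
    (fun J hJ => (lintegral_mono fun x => by gcongr).trans (test2 J (hsB hJ)))
  have cancel : ∀ s p : ℝ≥0∞, s ≠ 0 → s ≠ ∞ → s * (p / s) = p := fun s p hs hs' =>
    ENNReal.mul_div_cancel hs hs'
  rw [← Finset.sum_filter_add_sum_filter_not S P]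
  calc _ ≤ 400 * (∫⁻ x, F x ^ 2 ∂σ + ∫⁻ x, G x ^ 2 ∂ω) +
        400 * (∫⁻ x, G x ^ 2 ∂ω + ∫⁻ x, F x ^ 2 ∂σ) := by
        refine add_le_add (le_trans (le_of_eq (Finset.sum_congr rfl fun I hI => ?_)) hA)
          (le_trans (le_of_eq (Finset.sum_congr rfl fun I hI => ?_)) hB)
        · conv_lhs => rw [← cancel (σ I) (∫⁻ x in I, F x ∂σ) (h0 I (hsA hI)) (h1 I (hsA hI))]
          simp only [div_eq_mul_inv]; ring
        · conv_lhs => rw [← cancel (ω I) (∫⁻ x in I, G x ∂ω) (k0 I (hsB hI)) (k1 I (hsB hI))]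
          simp only [div_eq_mul_inv]; ring
    _ = _ := by ring

end TwoWeight

/-! ### Dyadic boxes and Wilson's rectangles. -/

section Geometry

/-- The dyadic interval `[p 2⁻ˢ, (p + 1) 2⁻ˢ)`. -/
def dyadicInterval (s p : ℤ) : Set ℝ :=
  Set.Ico ((p : ℝ) * 2 ^ (-s)) (((p : ℝ) + 1) * 2 ^ (-s))

theorem mem_dyadicInterval {s p : ℤ} {x : ℝ} : x ∈ dyadicInterval s p ↔ ⌊x * 2 ^ s⌋ = p := by
  have h : (0 : ℝ) < 2 ^ s := by positivity
  rw [dyadicInterval, Set.mem_Ico, Int.floor_eq_iff, zpow_neg, ← div_eq_mul_inv, ← div_eq_mul_inv,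
    div_le_iff₀ h, lt_div_iff₀ h]

/-- The coarse index is the integer quotient of the fine index by a power of two, so all points of a
fine interval share one coarse index. -/
theorem dyadicInterval_subset {s p s' p' : ℤ} (hs : s ≤ s') {x : ℝ}
    (hx : x ∈ dyadicInterval s p) (hx' : x ∈ dyadicInterval s' p') :
    dyadicInterval s' p' ⊆ dyadicInterval s p := by
  obtain ⟨m, rfl⟩ := Int.le.dest hs
  have key : ∀ y : ℝ, ⌊y * 2 ^ s⌋ = ⌊y * 2 ^ (s + m)⌋ / ((2 ^ m : ℕ) : ℤ) := by
    intro y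
    rw [← Int.floor_div_natCast]
    congr 1
    rw [zpow_add₀ (by norm_num)]
    push_cast
    rw [zpow_natCast]
    field_simp
  intro y hy
  rw [mem_dyadicInterval] at *
  rw [key, hy, ← hx', ← key, hx]

theorem dyadicInterval_nonempty (s p : ℤ) : (dyadicInterval s p).Nonempty := by
  have h : (0 : ℝ) < 2 ^ (-s) := by positivity
  exact ⟨_, Set.left_mem_Ico.2 (by nlinarith)⟩

theorem le_of_dyadicInterval_subset {s p s' p' : ℤ}
    (h : dyadicInterval s p ⊆ dyadicInterval s' p') : s' ≤ s := by
  have h0 : (0 : ℝ) < 2 ^ (-s) := by positivity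
  have h1 := (Set.Ico_subset_Ico_iff (by nlinarith)).1 h
  have h2 : (2 : ℝ) ^ (-s) ≤ 2 ^ (-s') := by linarith [h1.1, h1.2]
  have := (zpow_le_zpow_iff_right₀ (by norm_num : (1 : ℝ) < 2)).1 h2
  omega

/-- A box whose sides are the dyadic intervals of scales `s i` and positions `p i`. -/
def dyadicBox {n : ℕ} (s p : Fin n → ℤ) : Set (Fin n → ℝ) :=
  {x | ∀ i, x i ∈ dyadicInterval (s i) (p i)}

theorem dyadicBox_eq_pi {n : ℕ} (s p : Fin n → ℤ) :
    dyadicBox s p = Set.univ.pi fun i =>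
      Set.Ico ((p i : ℝ) * 2 ^ (-s i)) (((p i : ℝ) + 1) * 2 ^ (-s i)) := by
  ext x
  simp [dyadicBox, dyadicInterval]

theorem dyadicBox_nonempty {n : ℕ} (s p : Fin n → ℤ) : (dyadicBox s p).Nonempty := by
  choose x hx using fun i => dyadicInterval_nonempty (s i) (p i)
  exact ⟨x, hx⟩

theorem dyadicBox_subset {n : ℕ} {s p s' p' : Fin n → ℤ} (hs : s ≤ s') {x : Fin n → ℝ}
    (hx : x ∈ dyadicBox s p) (hx' : x ∈ dyadicBox s' p') : dyadicBox s' p' ⊆ dyadicBox s p :=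
  fun _ hy i => dyadicInterval_subset (hs i) (hx i) (hx' i) (hy i)

theorem le_of_dyadicBox_subset {n : ℕ} {s p s' p' : Fin n → ℤ}
    (h : dyadicBox s p ⊆ dyadicBox s' p') : s' ≤ s := by
  classical
  intro i
  obtain ⟨x, hx⟩ := dyadicBox_nonempty s p
  refine le_of_dyadicInterval_subset (p := p i) (p' := p' i) fun y hy => ?_
  have : Function.update x i y ∈ dyadicBox s p := by
    intro j
    by_cases hj : j = i
    · subst hj; simpa using hy
    · simpa [hj] using hx j
  simpa using h this i

theorem measurableSet_dyadicBox {n : ℕ} (s p : Fin n → ℤ) : MeasurableSet (dyadicBox s p) := by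
  rw [dyadicBox_eq_pi]
  exact MeasurableSet.univ_pi fun _ => measurableSet_Ico

theorem volume_dyadicBox_ne_zero {n : ℕ} (s p : Fin n → ℤ) : volume (dyadicBox s p) ≠ 0 := by
  rw [dyadicBox_eq_pi, Real.volume_pi_Ico]
  refine Finset.prod_ne_zero_iff.2 fun i _ => ?_
  have h0 : (0 : ℝ) < 2 ^ (-s i) := by positivity
  rw [Ne, ENNReal.ofReal_eq_zero, not_le]
  linarith

theorem dyadicBox_subset_compact {n : ℕ} (s p : Fin n → ℤ) :
    ∃ K, IsCompact K ∧ dyadicBox s p ⊆ K := by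
  refine ⟨Set.univ.pi fun i =>
      Set.Icc ((p i : ℝ) * 2 ^ (-s i)) (((p i : ℝ) + 1) * 2 ^ (-s i)),
    isCompact_univ_pi fun _ => isCompact_Icc, ?_⟩
  rw [dyadicBox_eq_pi]
  exact Set.pi_mono fun _ _ => Set.Ico_subset_Icc_self

theorem DyadicCube.toSet_eq_dyadicBox {n : ℕ} (Q : DyadicCube n) :
    Q.toSet = dyadicBox (fun _ => Q.scale) Q.pos := rfl

theorem prodLast_dyadicBox {n : ℕ} (s p : Fin n → ℤ) (t q : ℤ) :
    prodLast (dyadicBox s p) (dyadicInterval t q) =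
      dyadicBox (Fin.snoc s t : Fin (n + 1) → ℤ) (Fin.snoc p q : Fin (n + 1) → ℤ) := by
  ext x
  simp only [prodLast, dyadicBox, Set.mem_ofPred_eq, Fin.forall_fin_succ', Fin.snoc_castSucc,
    Fin.snoc_last]
  rfl

theorem prodLast_union_left {n : ℕ} (S T : Set (Fin n → ℝ)) (I : Set ℝ) :
    prodLast S I ∪ prodLast T I = prodLast (S ∪ T) I := by
  ext x
  simp only [prodLast, Set.mem_union, Set.mem_ofPred_eq]
  tauto

theorem prodLast_union_right {n : ℕ} (S : Set (Fin n → ℝ)) (I J : Set ℝ) :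
    prodLast S I ∪ prodLast S J = prodLast S (I ∪ J) := by
  ext x
  simp only [prodLast, Set.mem_union, Set.mem_ofPred_eq]
  tauto

theorem DyadicCube.lastLower_eq {n : ℕ} (Q : DyadicCube (n + 1)) :
    Q.lastLower = dyadicInterval (Q.scale + 1) (2 * Q.pos (Fin.last n)) := by
  have h : (2 : ℝ) ^ (-(Q.scale + 1)) = 2 ^ (-Q.scale) / 2 := by
    rw [neg_add, zpow_add₀ (by norm_num), zpow_neg_one]; rfl
  rw [DyadicCube.lastLower, dyadicInterval, h, DyadicCube.side]
  push_cast
  congr 1 <;> ring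

theorem DyadicCube.lastUpper_eq {n : ℕ} (Q : DyadicCube (n + 1)) :
    Q.lastUpper = dyadicInterval (Q.scale + 1) (2 * Q.pos (Fin.last n) + 1) := by
  have h : (2 : ℝ) ^ (-(Q.scale + 1)) = 2 ^ (-Q.scale) / 2 := by
    rw [neg_add, zpow_add₀ (by norm_num), zpow_neg_one]; rfl
  rw [DyadicCube.lastUpper, dyadicInterval, h, DyadicCube.side]
  push_cast
  congr 1 <;> ring

theorem DyadicCube.lastLower_union_lastUpper {n : ℕ} (Q : DyadicCube (n + 1)) :
    Q.lastLower ∪ Q.lastUpper = dyadicInterval Q.scale (Q.pos (Fin.last n)) := by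
  have h : (0 : ℝ) < 2 ^ (-Q.scale) := by positivity
  rw [DyadicCube.lastLower, DyadicCube.lastUpper, DyadicCube.side, dyadicInterval]
  exact Set.Ico_union_Ico_eq_Ico (by nlinarith) (by nlinarith)

/-- Wilson's rectangles are dyadic boxes, with the full side in some directions and half of it in
the remaining last ones. -/
theorem wilsonSet_eq_dyadicBox : ∀ (n : ℕ) (Q : DyadicCube n) (j : ℕ), j ∈ wilsonIndices n →
    ∃ s p : Fin n → ℤ, wilsonSet j Q = dyadicBox s p ∧ Monotone s ∧
      (∀ i, s i = Q.scale ∨ s i = Q.scale + 1) ∧ (∃ i, s i = Q.scale) ∧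
      wilsonSet j Q ⊆ Q.toSet
  | 0, _, j, hj => by simp [wilsonIndices] at hj
  | n + 1, Q, j, hj => by
    have hside : ∀ x : Fin (n + 1) → ℝ, Fin.init x ∈ Q.base.toSet →
        x (Fin.last n) ∈ dyadicInterval Q.scale (Q.pos (Fin.last n)) → x ∈ Q.toSet := by
      intro x h1 h2
      rw [DyadicCube.toSet_eq_dyadicBox, dyadicBox, Set.mem_ofPred_eq, Fin.forall_fin_succ']
      exact ⟨h1, h2⟩
    by_cases h1 : j = 1
    · have e : wilsonSet j Q = Q.toSet := by
        rw [wilsonSet, wilsonPair, if_pos h1, prodLast_union_right,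
          DyadicCube.lastLower_union_lastUpper]
        ext x
        refine ⟨fun h => hside x h.1 h.2, fun h => ?_⟩
        rw [DyadicCube.toSet_eq_dyadicBox, dyadicBox, Set.mem_ofPred_eq, Fin.forall_fin_succ'] at h
        exact h
      exact ⟨fun _ => Q.scale, Q.pos, e.trans Q.toSet_eq_dyadicBox, monotone_const,
        fun _ => Or.inl rfl, ⟨0, rfl⟩, e.subset⟩
    · have hj' : j / 2 ∈ wilsonIndices n := by
        rw [wilsonIndices, Finset.mem_Icc, pow_succ] at hj
        rw [wilsonIndices, Finset.mem_Icc]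
        omega
      obtain ⟨s, p, e, hmono, hs, ⟨i₀, hi₀⟩, hsub⟩ :=
        wilsonSet_eq_dyadicBox n Q.base (j / 2) hj'
      have hbase : Q.base.scale = Q.scale := rfl
      rw [hbase] at hs hi₀
      have hq : ∃ q, wilsonSet j Q =
          prodLast (wilsonSet (j / 2) Q.base) (dyadicInterval (Q.scale + 1) q) ∧
          dyadicInterval (Q.scale + 1) q ⊆ dyadicInterval Q.scale (Q.pos (Fin.last n)) := by
        rw [← DyadicCube.lastLower_union_lastUpper]
        by_cases h2 : j % 2 = 0
        · refine ⟨2 * Q.pos (Fin.last n), ?_, ?_⟩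
          · rw [wilsonSet, wilsonPair, if_neg h1, if_pos h2, prodLast_union_left,
              DyadicCube.lastLower_eq]
            rfl
          · rw [← DyadicCube.lastLower_eq]
            exact Set.subset_union_left
        · refine ⟨2 * Q.pos (Fin.last n) + 1, ?_, ?_⟩
          · rw [wilsonSet, wilsonPair, if_neg h1, if_neg h2, prodLast_union_left,
              DyadicCube.lastUpper_eq]
            rfl
          · rw [← DyadicCube.lastUpper_eq]
            exact Set.subset_union_right
      obtain ⟨q, hq, hqsub⟩ := hq
      refine ⟨Fin.snoc s (Q.scale + 1), Fin.snoc p q, ?_, ?_, ?_, ⟨i₀.castSucc, by simpa⟩, ?_⟩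
      · rw [hq, e, prodLast_dyadicBox]
      -- The appended last scale is the larger of the two permitted values, so monotonicity
      -- persists.
      · intro i k hik
        induction k using Fin.lastCases with
        | last =>
          induction i using Fin.lastCases with
          | last => simp
          | cast i => rcases hs i with h | h <;> simp [h]
        | cast k =>
          induction i using Fin.lastCases with
          | last => exact absurd hik (not_le.2 (Fin.castSucc_lt_last k))
          | cast i => simpa using hmono (Fin.castSucc_le_castSucc_iff.1 hik)
      · intro i
        induction i using Fin.lastCases with
        | last => simp
        | cast i => simpa using hs i
      · rw [hq]
        exact fun x hx => hside x (hsub hx.1) (hqsub hx.2)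

/-- Each scale vector is monotone with values in `{k, k + 1}`. Two such vectors are comparable: for
equal `k` both are single steps, for different `k` their ranges are ordered. Boxes with comparable
scales that share a point are nested. -/
theorem wilsonSet_laminar {n : ℕ} {Q Q' : DyadicCube n} {j j' : ℕ} (hj : j ∈ wilsonIndices n)
    (hj' : j' ∈ wilsonIndices n) : wilsonSet j Q ⊆ wilsonSet j' Q' ∨
      wilsonSet j' Q' ⊆ wilsonSet j Q ∨ Disjoint (wilsonSet j Q) (wilsonSet j' Q') := by
  obtain ⟨s, p, e, hmono, hs, -, -⟩ := wilsonSet_eq_dyadicBox n Q j hj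
  obtain ⟨s', p', e', hmono', hs', -, -⟩ := wilsonSet_eq_dyadicBox n Q' j' hj'
  rw [e, e']
  have hcomp : s ≤ s' ∨ s' ≤ s := by
    by_contra! h
    simp only [Pi.le_def, not_forall, not_le] at h
    obtain ⟨⟨i, hi⟩, ⟨k, hk⟩⟩ := h
    have h1 := hs i
    have h2 := hs k
    have h3 := hs' i
    have h4 := hs' k
    rcases le_total i k with h | h
    · have := hmono h
      have := hmono' h
      omega
    · have := hmono h
      have := hmono' h
      omega
  by_cases hd : Disjoint (dyadicBox s p) (dyadicBox s' p')
  · exact Or.inr (Or.inr hd)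
  · obtain ⟨x, hx, hx'⟩ := Set.not_disjoint_iff.1 hd
    rcases hcomp with h | h
    · exact Or.inr (Or.inl (dyadicBox_subset h hx hx'))
    · exact Or.inl (dyadicBox_subset h hx' hx)

/-- A direction in which `E_{j,Q}` has the full side of `Q` forces `Q` to be no larger than `Q'`,
even if `E_{i,Q'}` has half a side there. Hence the restriction `Q ⊆ Q'` in the Carleson sums is
automatic. -/
theorem toSet_subset_of_wilsonSet_subset {n : ℕ} {Q Q' : DyadicCube n} {j j' : ℕ}
    (hj : j ∈ wilsonIndices n) (hj' : j' ∈ wilsonIndices n)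
    (h : wilsonSet j Q ⊆ wilsonSet j' Q') : Q.toSet ⊆ Q'.toSet := by
  obtain ⟨s, p, e, -, -, ⟨i, hi⟩, hsub⟩ := wilsonSet_eq_dyadicBox n Q j hj
  obtain ⟨s', p', e', -, hs', -, hsub'⟩ := wilsonSet_eq_dyadicBox n Q' j' hj'
  have hle : Q'.scale ≤ Q.scale := by
    rw [e, e'] at h
    have h1 : s' i ≤ s i := le_of_dyadicBox_subset h i
    have h2 := hs' i
    omega
  obtain ⟨x, hx⟩ := dyadicBox_nonempty s p
  rw [← e] at hx
  exact dyadicBox_subset (fun _ => hle) (hsub' (h hx)) (hsub hx)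

end Geometry

/-! ### From weights and rectangles to measures on a laminar family. -/

section Bridge

variable {n : ℕ}

/-- The measure `w dx`. -/
noncomputable def weightMeasure (w : (Fin n → ℝ) → ℝ) : Measure (Fin n → ℝ) :=
  volume.withDensity fun x => ENNReal.ofReal (w x)

theorem IsWeight.integrableOn_dyadicBox {w : (Fin n → ℝ) → ℝ} (hw : IsWeight w)
    (s p : Fin n → ℤ) : IntegrableOn w (dyadicBox s p) := by
  obtain ⟨K, hK, hsub⟩ := dyadicBox_subset_compact s p
  exact (hw.2.integrableOn_isCompact hK).mono_set hsub

theorem volume_dyadicBox_ne_top (s p : Fin n → ℤ) : volume (dyadicBox s p) ≠ ∞ := by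
  obtain ⟨K, hK, hsub⟩ := dyadicBox_subset_compact s p
  exact measure_ne_top_of_subset hsub hK.measure_ne_top

theorem IsWeight.measure_dyadicBox_ne_top {w : (Fin n → ℝ) → ℝ} (hw : IsWeight w)
    (s p : Fin n → ℤ) : weightMeasure w (dyadicBox s p) ≠ ∞ := by
  rw [weightMeasure, withDensity_apply _ (measurableSet_dyadicBox s p)]
  exact (hw.integrableOn_dyadicBox s p).lintegral_lt_top.ne

theorem IsWeight.measure_dyadicBox_ne_zero {w : (Fin n → ℝ) → ℝ} (hw : IsWeight w)
    (s p : Fin n → ℤ) : weightMeasure w (dyadicBox s p) ≠ 0 := by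
  rw [weightMeasure, withDensity_apply _ (measurableSet_dyadicBox s p)]
  intro h
  rw [lintegral_eq_zero_iff'
    (hw.integrableOn_dyadicBox s p).aestronglyMeasurable.aemeasurable.ennreal_ofReal] at h
  have h2 : ∀ᵐ x ∂(volume.restrict (dyadicBox s p)), False := by
    filter_upwards [h, ae_restrict_of_ae hw.1] with x hx hx'
    exact absurd (ENNReal.ofReal_eq_zero.1 hx) (not_le.2 hx')
  rw [ae_iff] at h2
  simp [volume_dyadicBox_ne_zero] at h2

theorem IsWeight.avg_dyadicBox {w : (Fin n → ℝ) → ℝ} (hw : IsWeight w) (s p : Fin n → ℤ) :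
    avg w (dyadicBox s p) =
      (vol (dyadicBox s p))⁻¹ * (weightMeasure w (dyadicBox s p)).toReal := by
  rw [avg, weightMeasure, withDensity_apply _ (measurableSet_dyadicBox s p),
    integral_eq_lintegral_of_nonneg_ae]
  · filter_upwards [ae_restrict_of_ae hw.1] with x hx using hx.le
  · exact (hw.integrableOn_dyadicBox s p).aestronglyMeasurable

/-- A function in `L²(dx)` divided by `√w` is a function in `L²(w dx)`. -/
theorem IsWeight.exists_quotient {w : (Fin n → ℝ) → ℝ} (hw : IsWeight w)
    (f : Lp ℝ 2 (volume : Measure (Fin n → ℝ))) :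
    ∃ F : (Fin n → ℝ) → ℝ≥0∞, Measurable F ∧
      (∀ E, MeasurableSet E → ∫⁻ x in E, F x ∂weightMeasure w =
        ∫⁻ x in E, ENNReal.ofReal ‖f x * √(w x)‖) ∧
      ∫⁻ x, F x ^ 2 ∂weightMeasure w ≤ ENNReal.ofReal (‖f‖ ^ 2) := by
  have hwm : AEMeasurable w := hw.2.aestronglyMeasurable.aemeasurable
  have hfm : Measurable f := (Lp.stronglyMeasurable f).measurable
  -- The weight is only a.e. measurable; its measurable representative makes the quotient measurable
  -- everywhere.
  have hF : Measurable fun x => ENNReal.ofReal (|f x| / √(hwm.mk w x)) :=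
    (hfm.abs.div hwm.measurable_mk.sqrt).ennreal_ofReal
  refine ⟨_, hF, fun E hE => ?_, ?_⟩
  · rw [weightMeasure, restrict_withDensity hE,
      lintegral_withDensity_eq_lintegral_mul₀ hwm.ennreal_ofReal.restrict hF.aemeasurable]
    refine lintegral_congr_ae ?_
    filter_upwards [ae_restrict_of_ae hwm.ae_eq_mk, ae_restrict_of_ae hw.1] with x hx hx0
    rw [Pi.mul_apply, ← hx, ← ENNReal.ofReal_mul hx0.le, Real.norm_eq_abs, abs_mul,
      abs_of_nonneg (Real.sqrt_nonneg _)]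
    congr 1
    rw [mul_div_left_comm, Real.div_sqrt]
  · rw [weightMeasure,
      lintegral_withDensity_eq_lintegral_mul₀ hwm.ennreal_ofReal (hF.pow_const 2).aemeasurable]
    have hnorm : ENNReal.ofReal (‖f‖ ^ 2) = ∫⁻ x, ENNReal.ofReal (f x ^ 2) := by
      have h1 : ‖f‖ ^ 2 = ∫ x, f x ^ 2 := by
        rw [← real_inner_self_eq_norm_sq, L2.inner_def]
        exact integral_congr_ae (Filter.Eventually.of_forall fun x => by simp [sq])
      rw [h1, ofReal_integral_eq_lintegral_ofReal]
      · exact (Lp.memLp f).integrable_sq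
      · exact Filter.Eventually.of_forall fun x => sq_nonneg _
    rw [hnorm]
    refine lintegral_mono_ae ?_
    filter_upwards [hwm.ae_eq_mk, hw.1] with x hx hx0
    rw [Pi.mul_apply, ← hx, ← ENNReal.ofReal_pow (by positivity), ← ENNReal.ofReal_mul hx0.le,
      div_pow, Real.sq_sqrt hx0.le, sq_abs, mul_div_cancel₀ _ hx0.ne']

theorem abs_avg_le (h : (Fin n → ℝ) → ℝ) (E : Set (Fin n → ℝ)) :
    |avg h E| ≤ (vol E)⁻¹ * (∫⁻ x in E, ENNReal.ofReal ‖h x‖).toReal := by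
  have hv : 0 ≤ (vol E)⁻¹ := inv_nonneg.2 measureReal_nonneg
  rw [avg, abs_mul, abs_of_nonneg hv]
  exact mul_le_mul_of_nonneg_left (norm_integral_le_lintegral_norm h) hv

theorem avg_smul_mul (c : ℝ) (f : Lp ℝ 2 (volume : Measure (Fin n → ℝ)))
    (u : (Fin n → ℝ) → ℝ) (E : Set (Fin n → ℝ)) :
    avg (fun x => (c • f) x * u x) E = c * avg (fun x => f x * u x) E := by
  have h : ∫ x in E, (c • f) x * u x = ∫ x in E, c * (f x * u x) := by
    refine integral_congr_ae (ae_restrict_of_ae ?_)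
    filter_upwards [Lp.coeFn_smul c f] with x hx
    rw [hx, Pi.smul_apply, smul_eq_mul, mul_assoc]
  rw [avg, avg, h, integral_const_mul, mul_left_comm]

open Classical in
theorem sum_filter_le_localSum (β : ℕ → DyadicCube n → ℝ≥0∞) {i : ℕ} (hi : i ∈ wilsonIndices n)
    (Q' : DyadicCube n) (D : Finset (DyadicCube n)) :
    ∑ u ∈ (D ×ˢ wilsonIndices n).filter (fun u => wilsonSet u.2 u.1 ⊆ wilsonSet i Q'),
      β u.2 u.1 ≤ localSum β i Q' := by
  rw [Finset.sum_filter, Finset.sum_product]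
  have e : localSum β i Q' = ∑' Q, Set.indicator {Q : DyadicCube n | Q.toSet ⊆ Q'.toSet}
      (fun Q => ∑ j ∈ (wilsonIndices n).filter (fun j => wilsonSet j Q ⊆ wilsonSet i Q'),
        β j Q) Q :=
    tsum_subtype {Q : DyadicCube n | Q.toSet ⊆ Q'.toSet}
      (fun Q => ∑ j ∈ (wilsonIndices n).filter (fun j => wilsonSet j Q ⊆ wilsonSet i Q'), β j Q)
  rw [e]
  refine le_trans (Finset.sum_le_sum fun Q _ => ?_) (ENNReal.sum_le_tsum D)
  by_cases h : Q.toSet ⊆ Q'.toSet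
  · rw [Set.indicator_of_mem (show Q ∈ {Q : DyadicCube n | Q.toSet ⊆ Q'.toSet} from h),
      Finset.sum_filter]
  · rw [Finset.sum_eq_zero fun j hj => if_neg fun h' =>
      h (toSet_subset_of_wilsonSet_subset hj hi h')]
    exact zero_le

/-- Summing over an image with the weights summed over the fibres. -/
theorem sum_image_fiber {ι κ : Type*} [DecidableEq κ] (U : Finset ι) (φ : ι → κ)
    (c : ι → ℝ≥0∞) (x : κ → ℝ≥0∞) (P : κ → Prop) [DecidablePred P] :
    ∑ I ∈ (U.image φ).filter P, (∑ u ∈ U.filter (fun u => φ u = I), c u) * x I =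
      ∑ u ∈ U.filter (fun u => P (φ u)), c u * x (φ u) := by
  rw [Finset.sum_filter, Finset.sum_filter,
    ← Finset.sum_fiberwise_of_maps_to (fun u hu => Finset.mem_image_of_mem φ hu)]
  refine Finset.sum_congr rfl fun I _ => ?_
  by_cases h : P I
  · rw [if_pos h, Finset.sum_mul]
    refine Finset.sum_congr rfl fun u hu => ?_
    rw [(Finset.mem_filter.1 hu).2, if_pos h]
  · rw [if_neg h]
    refine (Finset.sum_eq_zero fun u hu => ?_).symm
    rw [(Finset.mem_filter.1 hu).2, if_neg h]

theorem sum_le_of_carlesonCondition {β K : ℕ → DyadicCube n → ℝ} (h : CarlesonCondition β K)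
    {i : ℕ} (hi : i ∈ wilsonIndices n) (Q' : DyadicCube n) (D : Finset (DyadicCube n))
    [DecidablePred fun u : DyadicCube n × ℕ => wilsonSet u.2 u.1 ⊆ wilsonSet i Q'] :
    ∑ u ∈ (D ×ˢ wilsonIndices n).filter (fun u => wilsonSet u.2 u.1 ⊆ wilsonSet i Q'),
      ENNReal.ofReal (β u.2 u.1) ≤ volume (wilsonSet i Q') * ENNReal.ofReal (K i Q') := by
  obtain ⟨s, p, e, -⟩ := wilsonSet_eq_dyadicBox n Q' i hi
  have hv : ENNReal.ofReal (vol (wilsonSet i Q')) = volume (wilsonSet i Q') := by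
    rw [e]; exact ENNReal.ofReal_toReal (volume_dyadicBox_ne_top s p)
  have h1 := h Q' i hi
  rw [hv] at h1
  have h0 : volume (wilsonSet i Q') ≠ 0 := by rw [e]; exact volume_dyadicBox_ne_zero s p
  have hT : volume (wilsonSet i Q') ≠ ∞ := by rw [e]; exact volume_dyadicBox_ne_top s p
  calc _ ≤ localSum (fun j Q => ENNReal.ofReal (β j Q)) i Q' := by
        convert sum_filter_le_localSum (fun j Q => ENNReal.ofReal (β j Q)) hi Q' D
    _ = volume (wilsonSet i Q') * ((volume (wilsonSet i Q'))⁻¹ *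
        localSum (fun j Q => ENNReal.ofReal (β j Q)) i Q') := by
        rw [← mul_assoc, ENNReal.mul_inv_cancel h0 hT, one_mul]
    _ ≤ _ := by gcongr

/-- The laminar theorem is applied to the image of the index pairs, each set carrying the sum of `α
/ A` over its fibre, so injectivity of `(j, Q) ↦ E_{j,Q}` is not needed. -/
theorem sum_form_le {w v : (Fin n → ℝ) → ℝ} (hw : IsWeight w) (hv : IsWeight v)
    {α : ℕ → DyadicCube n → ℝ} (hα : ∀ Q, ∀ j ∈ wilsonIndices n, 0 ≤ α j Q) {A : ℝ} (hA : 0 < A)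
    (hCv : CarlesonCondition
        (fun j Q => α j Q * avg v (wilsonSet j Q) * vol (wilsonSet j Q))
        (fun i Q' => A * avg v (wilsonSet i Q')))
    (hCw : CarlesonCondition
        (fun j Q => α j Q * avg w (wilsonSet j Q) * vol (wilsonSet j Q))
        (fun i Q' => A * avg w (wilsonSet i Q')))
    (hCwv : CarlesonCondition
        (fun j Q => α j Q * avg w (wilsonSet j Q) * avg v (wilsonSet j Q) * vol (wilsonSet j Q))
        (fun _ _ => A))
    (f g : Lp ℝ 2 (volume : Measure (Fin n → ℝ))) (D : Finset (DyadicCube n)) :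
    ∑ Q ∈ D, ∑ j ∈ wilsonIndices n,
          |α j Q * avg (fun x => f x * √(w x)) (wilsonSet j Q)
            * avg (fun x => g x * √(v x)) (wilsonSet j Q) * vol (wilsonSet j Q)|
          ≤ A * (800 * (‖f‖ ^ 2 + ‖g‖ ^ 2)) := by
  classical
  obtain ⟨F, hF, hFint, hF2⟩ := hw.exists_quotient f
  obtain ⟨G, hG, hGint, hG2⟩ := hv.exists_quotient g
  set σ := weightMeasure w with hσ
  set ω := weightMeasure v with hω
  set U := D ×ˢ wilsonIndices n with hU
  set φ : DyadicCube n × ℕ → Set (Fin n → ℝ) := fun u => wilsonSet u.2 u.1 with hφ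
  set S := U.image φ with hS
  set c : DyadicCube n × ℕ → ℝ≥0∞ := fun u => ENNReal.ofReal (α u.2 u.1) / ENNReal.ofReal A with hc
  have hA0 : ENNReal.ofReal A ≠ 0 := by simpa using hA
  have hbox : ∀ u ∈ U, ∃ s p : Fin n → ℤ, φ u = dyadicBox s p := by
    intro u hu
    obtain ⟨s, p, e, -⟩ := wilsonSet_eq_dyadicBox n u.1 u.2 (Finset.mem_product.1 hu).2
    exact ⟨s, p, e⟩
  have hSbox : ∀ I ∈ S, ∃ s p : Fin n → ℤ, I = dyadicBox s p := by
    intro I hI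
    obtain ⟨u, hu, rfl⟩ := Finset.mem_image.1 hI
    exact hbox u hu
  have hlam : IsLaminar S := by
    refine ⟨fun I hI => ?_, fun I hI J hJ => ?_⟩
    · obtain ⟨s, p, rfl⟩ := hSbox I hI
      exact dyadicBox_nonempty s p
    · obtain ⟨u, hu, rfl⟩ := Finset.mem_image.1 hI
      obtain ⟨u', hu', rfl⟩ := Finset.mem_image.1 hJ
      exact wilsonSet_laminar (Finset.mem_product.1 hu).2 (Finset.mem_product.1 hu').2
  have hm : ∀ I ∈ S, MeasurableSet I := by
    intro I hI
    obtain ⟨s, p, rfl⟩ := hSbox I hI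
    exact measurableSet_dyadicBox s p
  have m0 : ∀ I ∈ S, volume I ≠ 0 := by
    intro I hI
    obtain ⟨s, p, rfl⟩ := hSbox I hI
    exact volume_dyadicBox_ne_zero s p
  have m1 : ∀ I ∈ S, volume I ≠ ∞ := by
    intro I hI
    obtain ⟨s, p, rfl⟩ := hSbox I hI
    exact volume_dyadicBox_ne_top s p
  have s0 : ∀ I ∈ S, σ I ≠ 0 := by
    intro I hI
    obtain ⟨s, p, rfl⟩ := hSbox I hI
    exact hw.measure_dyadicBox_ne_zero s p
  have s1 : ∀ I ∈ S, σ I ≠ ∞ := by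
    intro I hI
    obtain ⟨s, p, rfl⟩ := hSbox I hI
    exact hw.measure_dyadicBox_ne_top s p
  have o0 : ∀ I ∈ S, ω I ≠ 0 := by
    intro I hI
    obtain ⟨s, p, rfl⟩ := hSbox I hI
    exact hv.measure_dyadicBox_ne_zero s p
  have o1 : ∀ I ∈ S, ω I ≠ ∞ := by
    intro I hI
    obtain ⟨s, p, rfl⟩ := hSbox I hI
    exact hv.measure_dyadicBox_ne_top s p
  -- On a set of finite measure, square integrability gives integrability through `H ≤ 1 + H²`.
  have fin : ∀ (τ : Measure (Fin n → ℝ)) (H : (Fin n → ℝ) → ℝ≥0∞) (I : Set (Fin n → ℝ)) (r : ℝ),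
      τ I ≠ ∞ → ∫⁻ x, H x ^ 2 ∂τ ≤ ENNReal.ofReal r → ∫⁻ x in I, H x ∂τ ≠ ∞ := by
    intro τ H I r hI hH
    refine ne_top_of_le_ne_top (ENNReal.add_ne_top.2 ⟨hI, ENNReal.ofReal_ne_top⟩)
      (le_trans ?_ (add_le_add_right hH (τ I)))
    calc ∫⁻ x in I, H x ∂τ ≤ ∫⁻ x in I, (1 + H x ^ 2) ∂τ := by
          refine lintegral_mono fun x => ?_
          simpa using ENNReal.mul_le_sq_add_sq 1 (H x)
      _ = τ I + ∫⁻ x in I, H x ^ 2 ∂τ := by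
          rw [lintegral_add_left measurable_const]; simp
      _ ≤ _ := by
          gcongr
          exact Measure.restrict_le_self
  have F1 : ∀ I ∈ S, ∫⁻ x in I, F x ∂σ ≠ ∞ := fun I hI => fin σ F I _ (s1 I hI) hF2
  have G1 : ∀ I ∈ S, ∫⁻ x in I, G x ∂ω ≠ ∞ := fun I hI => fin ω G I _ (o1 I hI) hG2
  have hvol : ∀ I : Set (Fin n → ℝ), vol I = (volume I).toReal := fun I => rfl
  have hpos : ∀ I ∈ S, 0 < vol I := fun I hI => ENNReal.toReal_pos (m0 I hI) (m1 I hI)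
  have hofvol : ∀ I ∈ S, ENNReal.ofReal (vol I) = volume I := fun I hI =>
    ENNReal.ofReal_toReal (m1 I hI)
  have avw : ∀ I ∈ S, avg w I = (vol I)⁻¹ * (σ I).toReal := by
    intro I hI
    obtain ⟨s, p, rfl⟩ := hSbox I hI
    exact hw.avg_dyadicBox s p
  have avv : ∀ I ∈ S, avg v I = (vol I)⁻¹ * (ω I).toReal := by
    intro I hI
    obtain ⟨s, p, rfl⟩ := hSbox I hI
    exact hv.avg_dyadicBox s p
  have hφS : ∀ u ∈ U, φ u ∈ S := fun u hu => Finset.mem_image_of_mem φ hu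
  have hαU : ∀ u ∈ U, 0 ≤ α u.2 u.1 := fun u hu => hα _ _ (Finset.mem_product.1 hu).2
  have scale : ∀ (V : Finset (DyadicCube n × ℕ)) (x : DyadicCube n × ℕ → ℝ≥0∞) (y : ℝ≥0∞),
      ∑ u ∈ V, ENNReal.ofReal (α u.2 u.1) * x u ≤ ENNReal.ofReal A * y →
      ∑ u ∈ V, c u * x u ≤ y := by
    intro V x y h
    have : ∑ u ∈ V, c u * x u =
        (ENNReal.ofReal A)⁻¹ * ∑ u ∈ V, ENNReal.ofReal (α u.2 u.1) * x u := by
      rw [Finset.mul_sum]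
      refine Finset.sum_congr rfl fun u _ => ?_
      rw [hc]; simp only [div_eq_mul_inv]; ring
    rw [this]
    calc _ ≤ (ENNReal.ofReal A)⁻¹ * (ENNReal.ofReal A * y) := by gcongr
      _ = y := by rw [← mul_assoc, ENNReal.inv_mul_cancel hA0 ENNReal.ofReal_ne_top, one_mul]
  have fiber : ∀ (x : Set (Fin n → ℝ) → ℝ≥0∞) (P : Set (Fin n → ℝ) → Prop) [DecidablePred P],
      ∑ I ∈ S.filter P, (∑ u ∈ U.filter (fun u => φ u = I), c u) * x I =
        ∑ u ∈ U.filter (fun u => P (φ u)), c u * x (φ u) :=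
    fun x P _ => sum_image_fiber U φ c x P
  have single : ∀ (z : (Fin n → ℝ) → ℝ) (τ : Measure (Fin n → ℝ)), (∀ I ∈ S, τ I ≠ ∞) →
      (∀ I ∈ S, avg z I = (vol I)⁻¹ * (τ I).toReal) →
      CarlesonCondition (fun j Q => α j Q * avg z (wilsonSet j Q) * vol (wilsonSet j Q))
        (fun i Q' => A * avg z (wilsonSet i Q')) →
      ∀ J ∈ S, ∑ I ∈ S.filter (· ⊆ J), (∑ u ∈ U.filter (fun u => φ u = I), c u) * τ I ≤ τ J := by
    intro z τ τ1 hz hC J hJ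
    rw [fiber τ (· ⊆ J)]
    refine scale _ (fun u => τ (φ u)) _ ?_
    obtain ⟨u', hu', rfl⟩ := Finset.mem_image.1 hJ
    have h := sum_le_of_carlesonCondition hC (Finset.mem_product.1 hu').2 u'.1 D
    refine le_trans (le_of_eq (Finset.sum_congr rfl fun u hu => ?_)) (h.trans (le_of_eq ?_))
    · have hu := (Finset.mem_filter.1 hu).1
      have hI := hφS u hu
      change _ = ENNReal.ofReal (α u.2 u.1 * avg z (φ u) * vol (φ u))
      have e : α u.2 u.1 * avg z (φ u) * vol (φ u) = α u.2 u.1 * (τ (φ u)).toReal := by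
        rw [hz _ hI]
        field_simp [(hpos _ hI).ne']
      rw [e, ENNReal.ofReal_mul (hαU u hu), ENNReal.ofReal_toReal (τ1 _ hI)]
    · change volume (φ u') * ENNReal.ofReal (A * avg z (φ u')) = _
      rw [← hofvol _ hJ, ← ENNReal.ofReal_mul (hpos _ hJ).le]
      have e : vol (φ u') * (A * avg z (φ u')) = A * (τ (φ u')).toReal := by
        rw [hz _ hJ]
        field_simp [(hpos _ hJ).ne']
      rw [e, ENNReal.ofReal_mul hA.le, ENNReal.ofReal_toReal (τ1 _ hJ)]
  have double : ∀ J ∈ S, ∑ I ∈ S.filter (· ⊆ J),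
      (∑ u ∈ U.filter (fun u => φ u = I), c u) * σ I * ω I / volume I ≤ volume J := by
    intro J hJ
    have e1 : ∀ I, (∑ u ∈ U.filter (fun u => φ u = I), c u) * σ I * ω I / volume I =
        (∑ u ∈ U.filter (fun u => φ u = I), c u) * (σ I * ω I / volume I) := fun I => by
      simp only [div_eq_mul_inv]; ring
    simp_rw [e1]
    rw [fiber (fun I => σ I * ω I / volume I) (· ⊆ J)]
    refine scale _ (fun u => σ (φ u) * ω (φ u) / volume (φ u)) _ ?_
    obtain ⟨u', hu', rfl⟩ := Finset.mem_image.1 hJ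
    have h := sum_le_of_carlesonCondition hCwv (Finset.mem_product.1 hu').2 u'.1 D
    refine le_trans (le_of_eq (Finset.sum_congr rfl fun u hu => ?_)) (h.trans (le_of_eq ?_))
    · have hu := (Finset.mem_filter.1 hu).1
      have hI := hφS u hu
      change _ = ENNReal.ofReal (α u.2 u.1 * avg w (φ u) * avg v (φ u) * vol (φ u))
      have e : α u.2 u.1 * avg w (φ u) * avg v (φ u) * vol (φ u) =
          α u.2 u.1 * ((σ (φ u)).toReal * (ω (φ u)).toReal / vol (φ u)) := by
        rw [avw _ hI, avv _ hI]
        field_simp [(hpos _ hI).ne']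
      rw [e, ENNReal.ofReal_mul (hαU u hu), ENNReal.ofReal_div_of_pos (hpos _ hI),
        ENNReal.ofReal_mul ENNReal.toReal_nonneg, ENNReal.ofReal_toReal (s1 _ hI),
        ENNReal.ofReal_toReal (o1 _ hI), hofvol _ hI]
    · exact mul_comm _ _
  have main := bilinear_embedding_laminar hlam hm m0 m1 s0 s1 o0 o1 hF hG F1 G1
    (single v ω o1 avv hCv) (single w σ s1 avw hCw) double
  have e2 : ∀ I, (∑ u ∈ U.filter (fun u => φ u = I), c u) * (∫⁻ x in I, F x ∂σ) *
      (∫⁻ x in I, G x ∂ω) / volume I = (∑ u ∈ U.filter (fun u => φ u = I), c u) *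
      ((∫⁻ x in I, F x ∂σ) * (∫⁻ x in I, G x ∂ω) / volume I) := fun I => by
    simp only [div_eq_mul_inv]; ring
  have e3 := fiber
    (fun I => (∫⁻ x in I, F x ∂σ) * (∫⁻ x in I, G x ∂ω) / volume I) (fun _ => True)
  simp only [Finset.filter_true] at e3
  simp_rw [e2] at main
  rw [e3] at main
  have main2 : ∑ u ∈ U, c u * ((∫⁻ x in φ u, F x ∂σ) * (∫⁻ x in φ u, G x ∂ω) / volume (φ u)) ≤
      ENNReal.ofReal (800 * (‖f‖ ^ 2 + ‖g‖ ^ 2)) := by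
    refine main.trans ?_
    rw [ENNReal.ofReal_mul (by norm_num), ENNReal.ofReal_add (by positivity) (by positivity),
      show ENNReal.ofReal 800 = 800 by simp]
    gcongr
  have main3 := ENNReal.toReal_le_of_le_ofReal (by positivity) main2
  rw [ENNReal.toReal_sum] at main3
  · rw [← Finset.sum_product' (f := fun Q j => |α j Q * avg (fun x => f x * √(w x)) (wilsonSet j Q)
            * avg (fun x => g x * √(v x)) (wilsonSet j Q) * vol (wilsonSet j Q)|)]
    refine le_trans ?_ (mul_le_mul_of_nonneg_left main3 hA.le)
    rw [Finset.mul_sum]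
    refine Finset.sum_le_sum fun u hu => ?_
    have hI := hφS u hu
    have p := hpos _ hI
    change |α u.2 u.1 * avg (fun x => f x * √(w x)) (φ u) * avg (fun x => g x * √(v x)) (φ u) *
      vol (φ u)| ≤ _
    rw [abs_mul, abs_mul, abs_mul, abs_of_nonneg (hαU u hu), abs_of_pos p]
    have b1 := abs_avg_le (fun x => f x * √(w x)) (φ u)
    have b2 := abs_avg_le (fun x => g x * √(v x)) (φ u)
    rw [← hFint _ (hm _ hI)] at b1
    rw [← hGint _ (hm _ hI)] at b2
    have hαu := hαU u hu
    calc _ ≤ α u.2 u.1 * ((vol (φ u))⁻¹ * (∫⁻ x in φ u, F x ∂σ).toReal) *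
          ((vol (φ u))⁻¹ * (∫⁻ x in φ u, G x ∂ω).toReal) * vol (φ u) := by gcongr
      _ = _ := by
        simp only [hc, ENNReal.toReal_mul, ENNReal.toReal_div, ENNReal.toReal_ofReal hαu,
          ENNReal.toReal_ofReal hA.le, ← hvol]
        field_simp
  · intro u hu
    have hI := hφS u hu
    exact ENNReal.mul_ne_top (ENNReal.div_ne_top ENNReal.ofReal_ne_top hA0)
      (ENNReal.div_ne_top (ENNReal.mul_ne_top (F1 _ hI) (G1 _ hI)) (m0 _ hI))

theorem exists_unit_smul {E : Type*} [NormedAddCommGroup E] [NormedSpace ℝ E] (f : E) :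
    ∃ f' : E, ‖f'‖ ≤ 1 ∧ f = ‖f‖ • f' := by
  by_cases h : f = 0
  · exact ⟨0, by simp, by simp [h]⟩
  · refine ⟨‖f‖⁻¹ • f, ?_, ?_⟩
    · rw [norm_smul, norm_inv, norm_norm, inv_mul_cancel₀ (norm_ne_zero_iff.2 h)]
    · rw [smul_smul, mul_inv_cancel₀ (norm_ne_zero_iff.2 h), one_smul]

end Bridge

/-! ### Homogenisation and passage to infinite sums. -/

theorem corollary4p5 :
    ∃ C : ℝ, 0 < C ∧
      ∀ (n : ℕ), 1 ≤ n →
      ∀ (w v : (Fin n → ℝ) → ℝ), IsWeight w → IsWeight v →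
      ∀ (α : ℕ → DyadicCube n → ℝ), (∀ Q, ∀ j ∈ wilsonIndices n, 0 ≤ α j Q) →
      ∀ (A : ℝ), 0 < A →
      CarlesonCondition
        (fun j Q => α j Q * avg v (wilsonSet j Q) * vol (wilsonSet j Q))
        (fun i Q' => A * avg v (wilsonSet i Q')) →
      CarlesonCondition
        (fun j Q => α j Q * avg w (wilsonSet j Q) * vol (wilsonSet j Q))
        (fun i Q' => A * avg w (wilsonSet i Q')) →
      CarlesonCondition
        (fun j Q => α j Q * avg w (wilsonSet j Q) * avg v (wilsonSet j Q) * vol (wilsonSet j Q))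
        (fun _ _ => A) →
      ∀ (f g : Lp ℝ 2 (volume : Measure (Fin n → ℝ))),
        Summable (fun Q : DyadicCube n => ∑ j ∈ wilsonIndices n,
          |α j Q * avg (fun x => f x * √(w x)) (wilsonSet j Q)
            * avg (fun x => g x * √(v x)) (wilsonSet j Q) * vol (wilsonSet j Q)|) ∧
        ∑' Q : DyadicCube n, ∑ j ∈ wilsonIndices n,
          |α j Q * avg (fun x => f x * √(w x)) (wilsonSet j Q)
            * avg (fun x => g x * √(v x)) (wilsonSet j Q) * vol (wilsonSet j Q)|
          ≤ C * A * ‖f‖ * ‖g‖ := by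
  -- For functions of norm at most 1, `sum_form_le` gives `800 * (1 + 1)`; bilinearity restores the
  -- norms. The bound is uniform over finite sets of cubes, which gives summability as well.
  refine ⟨1600, by norm_num, ?_⟩
  intro n _ w v hw hv α hα A hA hCv hCw hCwv f g
  have bound : ∀ D : Finset (DyadicCube n), ∑ Q ∈ D, ∑ j ∈ wilsonIndices n,
      |α j Q * avg (fun x => f x * √(w x)) (wilsonSet j Q)
        * avg (fun x => g x * √(v x)) (wilsonSet j Q) * vol (wilsonSet j Q)|
      ≤ 1600 * A * ‖f‖ * ‖g‖ := by
    intro D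
    obtain ⟨f', hf', hf⟩ := exists_unit_smul f
    obtain ⟨g', hg', hg⟩ := exists_unit_smul g
    have h := sum_form_le hw hv hα hA hCv hCw hCwv f' g' D
    have hterm : ∀ Q j, |α j Q * avg (fun x => f x * √(w x)) (wilsonSet j Q)
        * avg (fun x => g x * √(v x)) (wilsonSet j Q) * vol (wilsonSet j Q)| =
        ‖f‖ * ‖g‖ * |α j Q * avg (fun x => f' x * √(w x)) (wilsonSet j Q)
        * avg (fun x => g' x * √(v x)) (wilsonSet j Q) * vol (wilsonSet j Q)| := by
      intro Q j
      have ef : avg (fun x => f x * √(w x)) (wilsonSet j Q) =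
          ‖f‖ * avg (fun x => f' x * √(w x)) (wilsonSet j Q) := by
        rw [← avg_smul_mul, ← hf]
      have eg : avg (fun x => g x * √(v x)) (wilsonSet j Q) =
          ‖g‖ * avg (fun x => g' x * √(v x)) (wilsonSet j Q) := by
        rw [← avg_smul_mul, ← hg]
      rw [ef, eg, ← abs_of_nonneg (mul_nonneg (norm_nonneg f) (norm_nonneg g)), ← abs_mul]
      congr 1
      ring
    simp_rw [hterm, ← Finset.mul_sum]
    calc _ ≤ ‖f‖ * ‖g‖ * (A * (800 * (1 ^ 2 + 1 ^ 2))) := by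
          refine mul_le_mul_of_nonneg_left (h.trans ?_) (by positivity)
          gcongr
      _ = _ := by ring
  have hnn : ∀ Q : DyadicCube n, 0 ≤ ∑ j ∈ wilsonIndices n,
      |α j Q * avg (fun x => f x * √(w x)) (wilsonSet j Q)
        * avg (fun x => g x * √(v x)) (wilsonSet j Q) * vol (wilsonSet j Q)| :=
    fun Q => Finset.sum_nonneg fun j _ => abs_nonneg _
  exact ⟨summable_of_sum_le hnn bound, Real.tsum_le_of_sum_le hnn bound⟩
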